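/- Let $\rho$ be a density operator on a finite-dimensional bipartite Hilbert space $\mathbb C^{d_A}\otimes\mathbb C^{d_B}$, let $T_B$ denote partial transposition on the second system, $\langle X,Y\rangle=\operatorname{Tr}(X^\dagger Y)$, and $\|X\|_1=\operatorname{Tr}\sqrt{X^\dagger X}$. All logarithms are to base 2. Consider the sets of Hermitian operators $$\mathsf{PPT}=\{X \mid \operatorname{Tr}X=1,\ X^{T_B}\succeq 0\},\qquad \mathsf{PPT}_+=\{X\mid \operatorname{Tr}X=1,\ X\succeq 0,\ X^{T_B}\succeq 0\},\qquad \mathsf{PPT}'=\{X\mid \|X^{T_B}\|_1\le 1\}.$$ For a set $\mathcal Q$ of Hermitian operators let $\mathcal Q^\circ=\{W=W^\dagger\mid \langle W,X\rangle\le 1\ \forall X\in\mathcal Q\}$ and, for an integer $m\ge 1$, $$G^{(m)}_{\mathcal Q}(\rho)=\sup\{\langle\rho,W\rangle \mid 0\preceq W\preceq \mathbb 1,\ W\in\tfrac1m\mathcal Q^\circ\}.$$ A completely positive trace-preserving map $\Lambda:AB\to A'B'$ is called *PPT* if its Choi matrix satisfies $J_\Lambda^{T_{BB'}}\succeq 0$,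 *$\mathsf{PPT}$-preserving* if $X\in\mathsf{PPT}\Rightarrow\Lambda(X)\in\mathsf{PPT}$, and *$\mathsf{PPT}_+$-preserving* if $\sigma\in\mathsf{PPT}_+\Rightarrow\Lambda(\sigma)\in\mathsf{PPT}_+$. For a class $\mathcal O$ of such maps let $F_{\mathcal O}(\rho,m)=\sup_\Lambda\langle\Lambda(\rho),\Psi_m\rangle$, where the supremum is over the $\Lambda\in\mathcal O$ with output space $\mathbb C^m\otimes\mathbb C^m$ and $\Psi_m$ is the projector onto $\frac1{\sqrt m}\sum_{i=1}^m|ii\rangle$. For $0\le\varepsilon\le 1$ let $$E^{(1),\varepsilon}_{d,\mathcal O}(\rho)=\log\max\{m\ge 1 \mid F_{\mathcal O}(\rho,m)\ge 1-\varepsilon\},$$ where the value is read as $+\infty$ if the set is unbounded, and for Hermitian $X$ let $$D_H^\varepsilon(\rho\|X)=-\log\min\{\langle M,X\rangle\mid 0\preceq M\preceq\mathbb 1,\ 1-\langle M,\rho\rangle\le\varepsilon\}\in(-\infty,+\infty],$$ with $\log x=-\infty$ for $x\le 0$. Put $\lfloor x\rfloor_{\log}=\log\lfloor 2^x\rfloor$,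 with $\lfloor +\infty\rfloor_{\log}=+\infty$. **Theorem.** One has $\mathsf{PPT}'=\operatorname{conv}(\mathsf{PPT}\cup-\mathsf{PPT})$. For every integer $m\ge 1$, $$F_{\mathsf{PPT}_+\text{-preserving}}(\rho,m)=G^{(m)}_{\mathsf{PPT}_+}(\rho),\qquad F_{\mathrm{PPT}}(\rho,m)=F_{\mathsf{PPT}\text{-preserving}}(\rho,m)=G^{(m)}_{\mathsf{PPT}'}(\rho).$$ For every $0\le\varepsilon\le 1$, $$E^{(1),\varepsilon}_{d,\mathsf{PPT}_+\text{-preserving}}(\rho)=\Big\lfloor\min_{\sigma\in\mathsf{PPT}_+}D_H^\varepsilon(\rho\|\sigma)\Big\rfloor_{\log},\qquad E^{(1),\varepsilon}_{d,\mathrm{PPT}}(\rho)=E^{(1),\varepsilon}_{d,\mathsf{PPT}\text{-preserving}}(\rho)=\Big\lfloor\min_{X\in\mathsf{PPT}'}D_H^\varepsilon(\rho\|X)\Big\rfloor_{\log},$$ where both minima over operators are attained; for $\varepsilon<1$ the maximum in the definition of $E^{(1),\varepsilon}_{d,\mathcal O}(\rho)$ is attained for each of the three classes. -/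

import Mathlib

open scoped ComplexOrder MatrixOrder Pointwise

noncomputable section

namespace PPTDist

/-- Operators on a finite-dimensional space with orthonormal basis indexed by `I`. -/
abbrev Op (I : Type*) := Matrix I I ℂ

/-- Linear maps from operators on `I` to operators on `J`. -/
abbrev SuperOp (I J : Type*) := Op I →ₗ[ℂ] Op J

section Operators

variable {I : Type*} [Fintype I] [DecidableEq I]

/-- Hilbert-Schmidt inner product `Tr(X† Y)`, which is real for Hermitian `X`, `Y`. -/
def hs (X Y : Op I) : ℝ := (X.conjTranspose * Y).trace.re

/-- Trace norm `‖X‖₁ = Tr |X|` with `|X| = √(X† X)`. -/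
def traceNorm (X : Op I) : ℝ := (CFC.abs X).trace.re

/-- Density operators. -/
def IsState (ρ : Op I) : Prop := ρ.PosSemidef ∧ ρ.trace = 1

/-- Polar `{W Hermitian | ⟨W, X⟩ ≤ 1 for all X ∈ Q}` of a set of Hermitian operators. -/
def polar (Q : Set (Op I)) : Set (Op I) :=
  {W | W.IsHermitian ∧ ∀ X ∈ Q, hs W X ≤ 1}

/-- `G^{(m)}_Q(ρ) = sup {⟨ρ, W⟩ | 0 ≤ W ≤ 1, W ∈ (1/m) Q°}`. -/
def G (m : ℕ) (Q : Set (Op I)) (ρ : Op I) : ℝ :=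
  sSup {r | ∃ W : Op I, W.PosSemidef ∧ (1 - W).PosSemidef ∧
    W ∈ ((m : ℝ)⁻¹) • polar Q ∧ r = hs ρ W}

/-- Base-2 logarithm with the convention `log x = -∞` for `x ≤ 0`. -/
def log2 (x : ℝ) : EReal := if x ≤ 0 then ⊥ else ((Real.logb 2 x : ℝ) : EReal)

/-- `⌊x⌋_log = log ⌊2^x⌋`, extended by `⌊±∞⌋_log = ±∞`. -/
def logFloor (x : EReal) : EReal :=
  if x = ⊤ then ⊤ else if x = ⊥ then ⊥ else log2 ((⌊(2 : ℝ) ^ x.toReal⌋ : ℤ) : ℝ)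

/-- Hypothesis testing relative entropy
`D_H^ε(ρ‖X) = -log min {⟨M, X⟩ | 0 ≤ M ≤ 1, 1 - ⟨M, ρ⟩ ≤ ε}`. -/
def DH (ε : ℝ) (ρ X : Op I) : EReal :=
  -log2 (sInf {r | ∃ M : Op I, M.PosSemidef ∧ (1 - M).PosSemidef ∧
    1 - hs M ρ ≤ ε ∧ r = hs M X})

end Operators

section Channels

variable {I J : Type*} [Fintype I] [DecidableEq I] [Fintype J] [DecidableEq J]

/-- The map `id_k ⊗ Λ`, acting by `Λ` on every block of a `k × k` block matrix. -/
def ampl (k : ℕ) (Λ : SuperOp I J) (Z : Op (Fin k × I)) : Op (Fin k × J) :=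
  Matrix.of fun p q => Λ (Matrix.of fun a b => Z (p.1, a) (q.1, b)) p.2 q.2

/-- Complete positivity: every `id_k ⊗ Λ` preserves positive semidefiniteness. -/
def IsCP (Λ : SuperOp I J) : Prop :=
  ∀ (k : ℕ) (Z : Op (Fin k × I)), Z.PosSemidef → (ampl k Λ Z).PosSemidef

/-- Completely positive trace-preserving maps. -/
def IsCPTP (Λ : SuperOp I J) : Prop := IsCP Λ ∧ ∀ X : Op I, (Λ X).trace = X.trace

/-- Choi matrix `J_Λ = ∑ |a⟩⟨b| ⊗ Λ(|a⟩⟨b|)`. -/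
def choi (Λ : SuperOp I J) : Op (I × J) :=
  Matrix.of fun p q => Λ (Matrix.single p.1 q.1 1) p.2 q.2

end Channels

section Bipartite

variable {A B A' B' : Type*} [Fintype A] [DecidableEq A] [Fintype B] [DecidableEq B]
  [Fintype A'] [DecidableEq A'] [Fintype B'] [DecidableEq B']

/-- Partial transpose on the second factor. -/
def ptB (X : Op (A × B)) : Op (A × B) :=
  Matrix.of fun p q => X (p.1, q.2) (q.1, p.2)

/-- Partial transpose on `B` and `B'` of an operator on `AB ⊗ A'B'`. -/
def ptBB' (J : Op ((A × B) × (A' × B'))) : Op ((A × B) × (A' × B')) :=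
  Matrix.of fun p q =>
    J ((p.1.1, q.1.2), (p.2.1, q.2.2)) ((q.1.1, p.1.2), (q.2.1, p.2.2))

variable (A B A' B')

/-- `PPT = {X Hermitian | Tr X = 1, X^{T_B} ≥ 0}`. -/
def PPT : Set (Op (A × B)) :=
  {X | X.IsHermitian ∧ X.trace = 1 ∧ (ptB X).PosSemidef}

/-- `PPT₊ = {X Hermitian | Tr X = 1, X ≥ 0, X^{T_B} ≥ 0}`. -/
def PPTplus : Set (Op (A × B)) :=
  {X | X.IsHermitian ∧ X.trace = 1 ∧ X.PosSemidef ∧ (ptB X).PosSemidef}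

/-- `PPT' = {X Hermitian | ‖X^{T_B}‖₁ ≤ 1}`. -/
def PPTprime : Set (Op (A × B)) :=
  {X | X.IsHermitian ∧ traceNorm (ptB X) ≤ 1}

/-- PPT operations: channels whose Choi matrix is PPT with respect to `AA'|BB'`. -/
def PPTops : Set (SuperOp (A × B) (A' × B')) :=
  {Λ | IsCPTP Λ ∧ (ptBB' (choi Λ)).PosSemidef}

/-- PPT-preserving operations. -/
def PPTpres : Set (SuperOp (A × B) (A' × B')) :=
  {Λ | IsCPTP Λ ∧ ∀ X ∈ PPT A B, Λ X ∈ PPT A' B'}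

/-- PPT₊-preserving operations. -/
def PPTplusPres : Set (SuperOp (A × B) (A' × B')) :=
  {Λ | IsCPTP Λ ∧ ∀ X ∈ PPTplus A B, Λ X ∈ PPTplus A' B'}

variable {A B A' B'}

/-- The vector `|Ψ_m⟩ = ∑ i, |ii⟩ / √m`. -/
def maxEntVec (m : ℕ) : Fin m × Fin m → ℂ :=
  fun p => if p.1 = p.2 then ((Real.sqrt m)⁻¹ : ℝ) else 0

/-- The maximally entangled state `Ψ_m = |Ψ_m⟩⟨Ψ_m|`. -/
def maxEnt (m : ℕ) : Op (Fin m × Fin m) :=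
  Matrix.vecMulVec (maxEntVec m) (star (maxEntVec m))

/-- A class of operations: for every `m`, a set of maps from `AB` to two `m`-level systems. -/
abbrev OpClass (A B : Type*) := ∀ m : ℕ, Set (SuperOp (A × B) (Fin m × Fin m))

/-- Fidelity of distillation `F_O(ρ, m) = sup {⟨Λ(ρ), Ψ_m⟩ | Λ ∈ O}`. -/
def Fid (O : OpClass A B) (ρ : Op (A × B)) (m : ℕ) : ℝ :=
  sSup {r | ∃ Λ ∈ O m, r = hs (Λ ρ) (maxEnt m)}

/-- The sizes `m ≥ 1` of the states `Ψ_m` that can be distilled with error at most `ε`. -/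
def achievable (O : OpClass A B) (ε : ℝ) (ρ : Op (A × B)) : Set ℕ :=
  {m | 1 ≤ m ∧ 1 - ε ≤ Fid O ρ m}

/-- One-shot distillable entanglement: the logarithm of the largest achievable `m`
(`+∞` if there are arbitrarily large achievable `m`). -/
def Edist (O : OpClass A B) (ε : ℝ) (ρ : Op (A × B)) : EReal :=
  ⨆ m ∈ achievable O ε ρ, log2 (m : ℝ)

end Bipartite

end PPTDist

end

set_option linter.unusedSectionVars false

namespace PPTDist

open Matrix
open scoped Kronecker

/-! Write F for the swap. Everything rests on Ψ_m^{T_B} = F/m with F² = 1, so an operator X with Tr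
X = 1 and X^{T_B} ≥ 0 has |⟨Ψ_m, X⟩| ≤ 1/m (`abs_hs_maxEnt_le`).

Converse bound: pulling Ψ_m back through a channel gives an effect W (`IsCPTP.exists_dual_effect`).
If the channel preserves PPT or PPT₊, the bound above makes m⟨W, ·⟩ at most 1 on that set. For PPT
it holds in modulus, hence on the hull PPT' of ±PPT.

Achievability: measure W and prepare Ψ_m or (1 - Ψ_m)/(m² - 1). After partial transposition this
becomes a nonnegative combination of (1 + mw) ⊗ (1 + F) and (1 - mw) ⊗ (1 - F)
(`kronecker_isotropic`). Here w is ⟨W, X⟩ when one input is tested, and the transpose of W^{T_B}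
when the Choi matrix is tested. Positivity therefore reduces to -1 ≤ mw ≤ 1, which the polar
constraint supplies. PPT operations lie inside the PPT-preserving ones, so a converse for the larger
class and a construction in the smaller one settle both.

One-shot rates: for ε < 1, Sion's theorem gives a saddle point of ⟨M, X⟩ over tests and Q, with
value v in (0, 1] (`exists_minimax_DH`). Then G^{(m)} ≥ 1 - ε exactly when mv ≤ 1, so the largest m
is ⌊1/v⌋. At ε = 1 the zero test makes both sides infinite. -/

theorem posSemidef_real_smul {I : Type*} {P : Op I} (hP : P.PosSemidef) {r : ℝ} (hr : 0 ≤ r) :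
    (r • P).PosSemidef := hP.smul hr

theorem isClosed_setOf_isHermitian {I : Type*} : IsClosed {P : Op I | P.IsHermitian} :=
  isClosed_eq (by fun_prop) continuous_id

theorem convex_setOf_posSemidef {I : Type*} : Convex ℝ {P : Op I | P.PosSemidef} := by
  intro P hP Q hQ a b ha hb _
  exact (posSemidef_real_smul hP ha).add (posSemidef_real_smul hQ hb)

/-! ### Positive semidefinite operators and the Hilbert-Schmidt pairing -/

section Operators

variable {I : Type*} [Fintype I]

/-- Over ℂ a real-valued quadratic form already forces hermiticity, so no self-adjointness has to be
assumed. -/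
theorem posSemidef_of_forall_nonneg {M : Op I} (h : ∀ v : I → ℂ, 0 ≤ star v ⬝ᵥ (M *ᵥ v)) :
    M.PosSemidef := by
  classical
  rw [← Matrix.isPositive_toEuclideanLin_iff, LinearMap.isPositive_iff_complex]
  intro x
  have h2 : inner ℂ (M.toEuclideanLin x) x = star (star (x : I → ℂ) ⬝ᵥ (M *ᵥ (x : I → ℂ))) := by
    rw [← inner_conj_symm, EuclideanSpace.inner_eq_star_dotProduct]
    simp [Matrix.toLpLin_apply, dotProduct_comm]
  have h1 := Complex.nonneg_iff.mp (h x)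
  rw [h2]
  constructor
  · apply Complex.ext <;> simp [← h1.2]
  · simpa using h1.1

theorem exists_eq_conjTranspose_mul_self {P : Op I} (hP : P.PosSemidef) :
    ∃ C : Op I, P = Cᴴ * C := by
  classical
  exact CStarAlgebra.nonneg_iff_eq_star_mul_self.mp (Matrix.nonneg_iff_posSemidef.mpr hP)

theorem posSemidef_rankOne (v : I → ℂ) : (vecMulVec v (star v) : Op I).PosSemidef :=
  posSemidef_vecMulVec_self_star v

theorem trace_mul_rankOne (M : Op I) (v : I → ℂ) :
    (M * vecMulVec v (star v)).trace = star v ⬝ᵥ (M *ᵥ v) := by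
  rw [Matrix.mul_vecMulVec, trace_vecMulVec, dotProduct_comm]

theorem PosSemidef.trace_mul_nonneg {P Q : Op I} (hP : P.PosSemidef) (hQ : Q.PosSemidef) :
    0 ≤ (P * Q).trace := by
  obtain ⟨C, rfl⟩ := exists_eq_conjTranspose_mul_self hQ
  rw [← Matrix.mul_assoc, Matrix.trace_mul_comm, ← Matrix.mul_assoc]
  exact (hP.mul_mul_conjTranspose_same C).trace_nonneg

theorem hs_add_left (X Y Z : Op I) : hs (X + Y) Z = hs X Z + hs Y Z := by
  simp [hs, Matrix.add_mul]

theorem hs_add_right (X Y Z : Op I) : hs X (Y + Z) = hs X Y + hs X Z := by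
  simp [hs, Matrix.mul_add]

theorem hs_neg_left (X Y : Op I) : hs (-X) Y = -hs X Y := by
  simp [hs]

theorem hs_neg_right (X Y : Op I) : hs X (-Y) = -hs X Y := by
  simp [hs]

theorem hs_sub_left (X Y Z : Op I) : hs (X - Y) Z = hs X Z - hs Y Z := by
  simp [hs, Matrix.sub_mul]

theorem hs_smul_left (r : ℝ) (X Y : Op I) : hs (r • X) Y = r * hs X Y := by
  simp [hs]

theorem hs_smul_right (r : ℝ) (X Y : Op I) : hs X (r • Y) = r * hs X Y := by
  simp [hs]

theorem hs_comm (X Y : Op I) : hs X Y = hs Y X := by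
  have : (Yᴴ * X).trace = star (Xᴴ * Y).trace := by
    rw [← trace_conjTranspose, conjTranspose_mul, conjTranspose_conjTranspose]
  simp [hs, this]

theorem hs_one_left [DecidableEq I] (X : Op I) : hs 1 X = X.trace.re := by
  simp [hs]

theorem hs_one_right [DecidableEq I] (X : Op I) : hs X 1 = X.trace.re := by
  rw [hs_comm, hs_one_left]

theorem hs_zero_left (X : Op I) : hs 0 X = 0 := by simp [hs]

theorem hs_zero_right (X : Op I) : hs X 0 = 0 := by simp [hs]

theorem hs_of_isHermitian {W : Op I} (hW : W.IsHermitian) (X : Op I) :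
    hs W X = (W * X).trace.re := by
  rw [hs, hW.eq]

theorem trace_mul_eq_hs {W X : Op I} (hW : W.IsHermitian) (hX : X.IsHermitian) :
    (W * X).trace = (hs W X : ℂ) := by
  rw [hs_of_isHermitian hW]
  refine (Complex.conj_eq_iff_re.mp ?_).symm
  change star _ = _
  rw [← trace_conjTranspose, conjTranspose_mul, hW.eq, hX.eq, trace_mul_comm]

theorem hs_nonneg {P Q : Op I} (hP : P.PosSemidef) (hQ : Q.PosSemidef) : 0 ≤ hs P Q := by
  rw [hs_of_isHermitian hP.1]
  exact (Complex.nonneg_iff.mp (PosSemidef.trace_mul_nonneg hP hQ)).1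

theorem hs_le_trace [DecidableEq I] {W P : Op I} (hW : (1 - W).PosSemidef) (hP : P.PosSemidef) :
    hs W P ≤ P.trace.re := by
  have := hs_nonneg hW hP
  rw [hs_sub_left, hs_one_left] at this
  linarith

theorem trace_re_nonneg {P : Op I} (hP : P.PosSemidef) : 0 ≤ P.trace.re :=
  (Complex.nonneg_iff.mp hP.trace_nonneg).1

theorem trace_eq_re {X : Op I} (hX : X.IsHermitian) : X.trace = (X.trace.re : ℂ) := by
  refine (Complex.conj_eq_iff_re.mp ?_).symm
  change star _ = _
  rw [← trace_conjTranspose, hX.eq]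

/-- A Hermitian operator whose expectation in every state is at most one is at most the identity. -/
theorem posSemidef_one_sub_of_forall_hs_le [DecidableEq I] {H : Op I} (hH : H.IsHermitian)
    (h : ∀ P : Op I, P.PosSemidef → P.trace = 1 → hs H P ≤ 1) : (1 - H).PosSemidef := by
  refine posSemidef_of_forall_nonneg fun v => ?_
  rw [← trace_mul_rankOne, trace_mul_eq_hs (isHermitian_one.sub hH) (posSemidef_rankOne v).1]
  refine Complex.zero_le_real.mpr ?_
  rw [hs_sub_left, hs_one_left]
  set P : Op I := vecMulVec v (star v) with hPdef
  have hP : P.PosSemidef := posSemidef_rankOne v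
  -- The hypothesis concerns states only: normalise the rank-one operator unless it vanishes.
  rcases (trace_re_nonneg hP).eq_or_lt with h0 | h0
  · have : P = 0 := by
      rw [← hP.trace_eq_zero_iff, trace_eq_re hP.1, ← h0, Complex.ofReal_zero]
    simp [this, hs_zero_right]
  · have := h (P.trace.re⁻¹ • P) (posSemidef_real_smul hP (inv_nonneg.mpr h0.le)) (by
      rw [trace_smul, trace_eq_re hP.1, Complex.ofReal_re, Complex.real_smul,
        ← Complex.ofReal_mul, inv_mul_cancel₀ h0.ne', Complex.ofReal_one])
    rw [hs_smul_right, inv_mul_le_one₀ h0] at this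
    linarith

end Operators

/-! ### Trace norm and Jordan decomposition -/

section TraceNorm

variable {I : Type*} [Fintype I] [DecidableEq I]

theorem exists_sub_eq_of_isHermitian {Y : Op I} (hY : Y.IsHermitian) :
    ∃ P N : Op I, P.PosSemidef ∧ N.PosSemidef ∧ Y = P - N ∧
      P.trace.re + N.trace.re = traceNorm Y := by
  have hY' : IsSelfAdjoint Y := hY
  refine ⟨Y⁺, Y⁻, nonneg_iff_posSemidef.mp (CFC.posPart_nonneg Y),
    nonneg_iff_posSemidef.mp (CFC.negPart_nonneg Y), (CFC.posPart_sub_negPart Y).symm, ?_⟩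
  rw [traceNorm, ← CFC.posPart_add_negPart Y, trace_add, Complex.add_re]

theorem traceNorm_eq_sum_abs_eigenvalues {Y : Op I} (hY : Y.IsHermitian) :
    traceNorm Y = ∑ i, |hY.eigenvalues i| := by
  have hY' : IsSelfAdjoint Y := hY
  rw [traceNorm, CFC.abs_eq_cfc_norm Y, hY.cfc_eq, IsHermitian.cfc,
    Unitary.conjStarAlgAut_apply, trace_mul_cycle, Unitary.coe_star_mul_self, one_mul,
    trace_diagonal, Complex.re_sum]
  simp

/-- In an eigenbasis of the difference, each eigenvalue is a difference of nonnegative diagonal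
entries of `P` and `N`, so its modulus is at most their sum; the traces are basis independent. -/
theorem traceNorm_sub_le {P N : Op I} (hP : P.PosSemidef) (hN : N.PosSemidef) :
    traceNorm (P - N) ≤ P.trace.re + N.trace.re := by
  have hY : (P - N).IsHermitian := hP.1.sub hN.1
  set U : Op I := hY.eigenvectorUnitary.1 with hU
  have hUU : U * Uᴴ = 1 := Unitary.coe_mul_star_self hY.eigenvectorUnitary
  have htr (X : Op I) : (Uᴴ * X * U).trace = X.trace := by
    rw [trace_mul_cycle, hUU, one_mul]
  have hd : Uᴴ * (P - N) * U = diagonal (RCLike.ofReal ∘ hY.eigenvalues) := by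
    have := hY.conjStarAlgAut_star_eigenvectorUnitary
    rwa [Unitary.conjStarAlgAut_star_apply] at this
  have hP' := hP.conjTranspose_mul_mul_same U
  have hN' := hN.conjTranspose_mul_mul_same U
  rw [traceNorm_eq_sum_abs_eigenvalues hY, ← htr P, ← htr N, trace, trace, Complex.re_sum,
    Complex.re_sum, ← Finset.sum_add_distrib]
  refine Finset.sum_le_sum fun i _ => ?_
  have h1 := (Complex.nonneg_iff.mp (hP'.diag_nonneg (i := i))).1
  have h2 := (Complex.nonneg_iff.mp (hN'.diag_nonneg (i := i))).1
  have h3 : hY.eigenvalues i = ((Uᴴ * P * U) i i).re - ((Uᴴ * N * U) i i).re := by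
    have := congrArg Complex.re (congrFun (congrFun hd i) i)
    rw [Matrix.mul_sub, Matrix.sub_mul] at this
    simpa using this.symm
  rw [h3, diag_apply, diag_apply, abs_le]
  constructor <;> linarith

end TraceNorm

/-! ### Compactness of positive operators of bounded trace and of effects -/

section Compactness

variable {I : Type*} [Fintype I]

theorem isClosed_setOf_posSemidef : IsClosed {P : Op I | P.PosSemidef} := by
  have : {P : Op I | P.PosSemidef} = ⋂ v : I → ℂ, {P | 0 ≤ star v ⬝ᵥ (P *ᵥ v)} := by
    ext P
    simp only [Set.mem_ofPred_eq, Set.mem_iInter]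
    exact ⟨fun h v => h.dotProduct_mulVec_nonneg v, posSemidef_of_forall_nonneg⟩
  rw [this]
  refine isClosed_iInter fun v => isClosed_le continuous_const ?_
  fun_prop

/-- Write P = C†C. Since Tr P is the sum of all |C_ij|², the factor C lies in a box of radius √c,
and the set is a closed subset of the continuous image of that box. -/
theorem isCompact_setOf_posSemidef_trace_le (c : ℝ) :
    IsCompact {P : Op I | P.PosSemidef ∧ P.trace.re ≤ c} := by
  have hK : IsCompact (Set.pi Set.univ fun _ : I => Set.pi Set.univ fun _ : I =>
      Metric.closedBall (0 : ℂ) (Real.sqrt c)) :=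
    isCompact_univ_pi fun _ => isCompact_univ_pi fun _ => isCompact_closedBall _ _
  have hf : Continuous fun C : Op I => Cᴴ * C := by fun_prop
  refine (hK.image hf).of_isClosed_subset ?_ ?_
  · exact isClosed_setOf_posSemidef.inter
      (isClosed_le (Complex.continuous_re.comp (continuous_id.matrix_trace)) continuous_const)
  · rintro P ⟨hP, hc⟩
    obtain ⟨C, rfl⟩ := exists_eq_conjTranspose_mul_self hP
    refine ⟨C, fun i _ j _ => ?_, rfl⟩
    rw [mem_closedBall_zero_iff]
    refine Real.le_sqrt_of_sq_le (le_trans ?_ hc)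
    have : (Cᴴ * C).trace.re = ∑ b, ∑ a, ‖C a b‖ ^ 2 := by
      simp [trace, Matrix.mul_apply, Complex.sq_norm, Complex.normSq_apply]
    rw [this]
    refine le_trans ?_ (Finset.single_le_sum (f := fun b => ∑ a, ‖C a b‖ ^ 2)
      (fun b _ => Finset.sum_nonneg fun a _ => sq_nonneg _) (Finset.mem_univ j))
    exact Finset.single_le_sum (f := fun a => ‖C a j‖ ^ 2) (fun a _ => sq_nonneg _)
      (Finset.mem_univ i)

variable [DecidableEq I]

theorem isCompact_effects : IsCompact {M : Op I | M.PosSemidef ∧ (1 - M).PosSemidef} := by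
  refine (isCompact_setOf_posSemidef_trace_le (I := I) (Fintype.card I)).of_isClosed_subset ?_ ?_
  · exact isClosed_setOf_posSemidef.inter
      (isClosed_setOf_posSemidef.preimage (continuous_const.sub continuous_id))
  · rintro M ⟨h0, h1⟩
    have := trace_re_nonneg h1
    rw [trace_sub, trace_one, Complex.sub_re, Complex.natCast_re] at this
    exact ⟨h0, by linarith⟩

theorem convex_effects : Convex ℝ {M : Op I | M.PosSemidef ∧ (1 - M).PosSemidef} := by
  refine convex_setOf_posSemidef.inter ?_
  intro M hM N hN a b ha hb hab
  have : (1 : Op I) - (a • M + b • N) = a • (1 - M) + b • (1 - N) := by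
    rw [smul_sub, smul_sub, sub_add_sub_comm, ← add_smul, hab, one_smul]
  change (1 - (a • M + b • N)).PosSemidef
  rw [this]
  exact (posSemidef_real_smul hM ha).add (posSemidef_real_smul hN hb)

end Compactness

/-! ### Partial transposition -/

section PartialTranspose

variable {A B : Type*}

theorem ptB_apply (X : Op (A × B)) (p q : A × B) : ptB X p q = X (p.1, q.2) (q.1, p.2) := rfl

theorem ptB_ptB (X : Op (A × B)) : ptB (ptB X) = X := rfl

theorem ptB_add (X Y : Op (A × B)) : ptB (X + Y) = ptB X + ptB Y := rfl

theorem ptB_sub (X Y : Op (A × B)) : ptB (X - Y) = ptB X - ptB Y := rfl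

theorem ptB_neg (X : Op (A × B)) : ptB (-X) = -ptB X := rfl

theorem ptB_smul {R : Type*} [SMul R ℂ] (r : R) (X : Op (A × B)) : ptB (r • X) = r • ptB X := rfl

theorem isHermitian_ptB {X : Op (A × B)} (hX : X.IsHermitian) : (ptB X).IsHermitian := by
  ext p q
  exact hX.apply _ _

theorem isHermitian_of_ptB {X : Op (A × B)} (hX : (ptB X).IsHermitian) : X.IsHermitian :=
  isHermitian_ptB hX

theorem continuous_ptB : Continuous (ptB : Op (A × B) → Op (A × B)) :=
  continuous_matrix fun _ _ => (continuous_apply_apply _ _)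

theorem ptB_one [DecidableEq A] [DecidableEq B] : ptB (1 : Op (A × B)) = 1 := by
  ext p q
  simp only [ptB_apply, one_apply, Prod.ext_iff]
  congr 1
  simp [eq_comm]

theorem ptB_single [DecidableEq A] [DecidableEq B] (a b : A × B) :
    ptB (single a b (1 : ℂ)) = single (a.1, b.2) (b.1, a.2) 1 := by
  ext p q
  simp only [ptB_apply, single_apply, Prod.ext_iff]
  congr 1
  simp only [eq_iff_iff]
  tauto

variable [Fintype A] [Fintype B]

theorem trace_ptB (X : Op (A × B)) : (ptB X).trace = X.trace := rfl

/-- Partial transposition of both factors merely exchanges the names of the two summed B-indices. -/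
theorem trace_ptB_mul_ptB (X Y : Op (A × B)) : (ptB X * ptB Y).trace = (X * Y).trace := by
  simp only [trace, diag_apply, Matrix.mul_apply, ptB_apply, Fintype.sum_prod_type]
  refine Finset.sum_congr rfl fun a _ => ?_
  rw [Finset.sum_comm]
  conv_rhs => rw [Finset.sum_comm]
  refine Finset.sum_congr rfl fun a' _ => ?_
  rw [Finset.sum_comm]

theorem hs_ptB {X : Op (A × B)} (hX : X.IsHermitian) (Y : Op (A × B)) :
    hs (ptB X) (ptB Y) = hs X Y := by
  rw [hs_of_isHermitian hX, hs_of_isHermitian (isHermitian_ptB hX), trace_ptB_mul_ptB]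

end PartialTranspose

/-! ### Convex geometry of PPT, PPT₊ and PPT' -/

section Sets

variable {A B : Type*} [Fintype A] [DecidableEq A] [Fintype B] [DecidableEq B]

/-- Trading the trace norm for a pair of positive operators makes compactness and convexity of PPT'
elementary. -/
theorem mem_PPTprime_iff {X : Op (A × B)} : X ∈ PPTprime A B ↔
    ∃ P N : Op (A × B), P.PosSemidef ∧ N.PosSemidef ∧ P.trace.re + N.trace.re ≤ 1 ∧
      X = ptB (P - N) := by
  constructor
  · rintro ⟨hX, h⟩
    obtain ⟨P, N, hP, hN, hX', htr⟩ := exists_sub_eq_of_isHermitian (isHermitian_ptB hX)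
    exact ⟨P, N, hP, hN, htr.le.trans h, by rw [← hX', ptB_ptB]⟩
  · rintro ⟨P, N, hP, hN, h, rfl⟩
    exact ⟨isHermitian_ptB (hP.1.sub hN.1), (traceNorm_sub_le hP hN).trans h⟩

theorem PPTprime_eq_image : PPTprime A B =
    (fun p : Op (A × B) × Op (A × B) => ptB (p.1 - p.2)) ''
      {p | p.1.PosSemidef ∧ p.2.PosSemidef ∧ p.1.trace.re + p.2.trace.re ≤ 1} := by
  ext X
  rw [mem_PPTprime_iff]
  constructor
  · rintro ⟨P, N, hP, hN, h, rfl⟩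
    exact ⟨(P, N), ⟨hP, hN, h⟩, rfl⟩
  · rintro ⟨⟨P, N⟩, ⟨hP, hN, h⟩, rfl⟩
    exact ⟨P, N, hP, hN, h, rfl⟩

theorem isCompact_PPTprime : IsCompact (PPTprime A B) := by
  rw [PPTprime_eq_image]
  have hK := isCompact_setOf_posSemidef_trace_le (I := A × B) 1
  refine ((hK.prod hK).of_isClosed_subset ?_ ?_).image
    (continuous_ptB.comp (continuous_fst.sub continuous_snd))
  · have htr : Continuous fun p : Op (A × B) × Op (A × B) => p.1.trace.re + p.2.trace.re :=
      (Complex.continuous_re.comp continuous_fst.matrix_trace).add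
        (Complex.continuous_re.comp continuous_snd.matrix_trace)
    exact (isClosed_setOf_posSemidef.preimage continuous_fst).inter
      ((isClosed_setOf_posSemidef.preimage continuous_snd).inter
        (isClosed_le htr continuous_const))
  · rintro ⟨P, N⟩ ⟨hP, hN, h⟩
    have h1 := trace_re_nonneg hP
    have h2 := trace_re_nonneg hN
    dsimp only at h
    exact ⟨⟨hP, by linarith⟩, ⟨hN, by linarith⟩⟩

theorem convex_PPTprime : Convex ℝ (PPTprime A B) := by
  intro X hX Y hY a b ha hb hab
  obtain ⟨P, N, hP, hN, h, rfl⟩ := mem_PPTprime_iff.mp hX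
  obtain ⟨P', N', hP', hN', h', rfl⟩ := mem_PPTprime_iff.mp hY
  refine mem_PPTprime_iff.mpr ⟨a • P + b • P', a • N + b • N',
    (posSemidef_real_smul hP ha).add (posSemidef_real_smul hP' hb),
    (posSemidef_real_smul hN ha).add (posSemidef_real_smul hN' hb), ?_, ?_⟩
  · simp only [trace_add, trace_smul, Complex.add_re, Complex.real_smul, Complex.re_ofReal_mul]
    nlinarith
  · rw [← ptB_smul, ← ptB_smul, ← ptB_add]
    congr 1
    simp only [smul_sub]
    abel

theorem PPT_subset_PPTprime : PPT A B ⊆ PPTprime A B := by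
  rintro X ⟨_, htr, hpos⟩
  refine mem_PPTprime_iff.mpr ⟨ptB X, 0, hpos, PosSemidef.zero, ?_, by rw [sub_zero, ptB_ptB]⟩
  rw [trace_ptB, htr]
  simp

theorem neg_PPT_subset_PPTprime : -PPT A B ⊆ PPTprime A B := by
  rintro X ⟨_, htr, hpos⟩
  refine mem_PPTprime_iff.mpr ⟨0, ptB (-X), PosSemidef.zero, hpos, ?_, ?_⟩
  · rw [trace_ptB, htr]
    simp
  · rw [zero_sub, ← ptB_neg, neg_neg, ptB_ptB]

theorem PPTplus_subset_PPT : PPTplus A B ⊆ PPT A B := fun _ ⟨h1, h2, _, h4⟩ => ⟨h1, h2, h4⟩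

theorem convex_PPTplus : Convex ℝ (PPTplus A B) := by
  rintro X ⟨_, hX2, hX3, hX4⟩ Y ⟨_, hY2, hY3, hY4⟩ a b ha hb hab
  have h3 := (posSemidef_real_smul hX3 ha).add (posSemidef_real_smul hY3 hb)
  refine ⟨h3.1, ?_, h3, (posSemidef_real_smul hX4 ha).add (posSemidef_real_smul hY4 hb)⟩
  rw [trace_add, trace_smul, trace_smul, hX2, hY2, ← add_smul, hab, one_smul]

theorem isCompact_PPTplus : IsCompact (PPTplus A B) := by
  refine (isCompact_setOf_posSemidef_trace_le (I := A × B) 1).of_isClosed_subset ?_ ?_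
  · exact isClosed_setOf_isHermitian.inter ((isClosed_eq continuous_id.matrix_trace
      continuous_const).inter (isClosed_setOf_posSemidef.inter
        (isClosed_setOf_posSemidef.preimage continuous_ptB)))
  · rintro X ⟨_, h2, h3, _⟩
    exact ⟨h3, by rw [h2, Complex.one_re]⟩

theorem maximallyMixed_mem_PPTplus [Nonempty A] [Nonempty B] :
    ((Fintype.card (A × B) : ℝ)⁻¹ • (1 : Op (A × B))) ∈ PPTplus A B := by
  have h : ((Fintype.card (A × B) : ℝ)⁻¹ • (1 : Op (A × B))).PosSemidef :=
    posSemidef_real_smul PosSemidef.one (by positivity)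
  refine ⟨h.1, ?_, h, ?_⟩
  · rw [trace_smul, trace_one, Complex.real_smul, Complex.ofReal_inv, Complex.ofReal_natCast]
    exact inv_mul_cancel₀ (Nat.cast_ne_zero.mpr Fintype.card_ne_zero)
  · rw [ptB_smul, ptB_one]
    exact h

theorem inv_trace_smul_mem_PPT {P : Op (A × B)} (hP : P.PosSemidef) (h0 : 0 < P.trace.re) :
    P.trace.re⁻¹ • ptB P ∈ PPT A B := by
  have h : (P.trace.re⁻¹ • P).PosSemidef := posSemidef_real_smul hP (inv_nonneg.mpr h0.le)
  refine ⟨isHermitian_ptB h.1, ?_, h⟩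
  rw [trace_smul, trace_ptB, trace_eq_re hP.1, Complex.ofReal_re, Complex.real_smul,
    ← Complex.ofReal_mul, inv_mul_cancel₀ h0.ne', Complex.ofReal_one]

/-- The origin is the midpoint of `z` and `-z`; it absorbs the missing weight 1 - (p + q). -/
theorem smul_add_smul_neg_mem {E : Type*} [AddCommGroup E] [Module ℝ E] {K : Set E}
    (hK : Convex ℝ K) {x y z : E} (hx : x ∈ K) (hy : -y ∈ K) (hz : z ∈ K) (hz' : -z ∈ K)
    {p q : ℝ} (hp : 0 ≤ p) (hq : 0 ≤ q) (hpq : p + q ≤ 1) : p • x - q • y ∈ K := by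
  have h0 : (0 : E) ∈ K := by
    have := hK hz hz' (a := 1 / 2) (b := 1 / 2) (by norm_num) (by norm_num) (by norm_num)
    rwa [smul_neg, add_neg_cancel] at this
  rcases (add_nonneg hp hq).eq_or_lt with hs | hs
  · have hp0 : p = 0 := by linarith
    have hq0 : q = 0 := by linarith
    simpa [hp0, hq0] using h0
  have h1 := hK hx hy (a := p / (p + q)) (b := q / (p + q)) (by positivity) (by positivity)
    (by field_simp)
  have h2 := hK h1 h0 (a := p + q) (b := 1 - (p + q)) hs.le (by linarith) (by ring)
  convert h2 using 1
  rw [smul_zero, add_zero, smul_add, smul_smul, smul_smul, mul_div_cancel₀ _ hs.ne',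
    mul_div_cancel₀ _ hs.ne', smul_neg, sub_eq_add_neg]

theorem PPTprime_eq_convexHull [Nonempty A] [Nonempty B] :
    PPTprime A B = convexHull ℝ (PPT A B ∪ -PPT A B) := by
  refine Set.Subset.antisymm (fun X hX => ?_) (convexHull_min
    (Set.union_subset PPT_subset_PPTprime neg_PPT_subset_PPTprime) convex_PPTprime)
  obtain ⟨P, N, hP, hN, h, rfl⟩ := mem_PPTprime_iff.mp hX
  have hmem {Z : Op (A × B)} (hZ : Z ∈ PPT A B) :
      Z ∈ convexHull ℝ (PPT A B ∪ -PPT A B) ∧ -Z ∈ convexHull ℝ (PPT A B ∪ -PPT A B) :=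
    ⟨subset_convexHull _ _ (Or.inl hZ),
      subset_convexHull _ _ (Or.inr (by rwa [Set.mem_neg, neg_neg]))⟩
  obtain ⟨hz, hz'⟩ := hmem (PPTplus_subset_PPT (maximallyMixed_mem_PPTplus (A := A) (B := B)))
  -- Normalise by the trace; when the trace is zero any PPT element serves, since its weight is
  -- zero.
  have key {P : Op (A × B)} (hP : P.PosSemidef) :
      ∃ Z ∈ PPT A B, ptB P = P.trace.re • Z := by
    rcases (trace_re_nonneg hP).eq_or_lt with h0 | h0
    · have : P = 0 := by
        rw [← hP.trace_eq_zero_iff, trace_eq_re hP.1, ← h0, Complex.ofReal_zero]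
      refine ⟨_, PPTplus_subset_PPT (maximallyMixed_mem_PPTplus (A := A) (B := B)), ?_⟩
      rw [← h0, zero_smul, this]
      rfl
    · exact ⟨_, inv_trace_smul_mem_PPT hP h0, by rw [smul_smul, mul_inv_cancel₀ h0.ne', one_smul]⟩
  obtain ⟨x, hx, hPx⟩ := key hP
  obtain ⟨y, hy, hNy⟩ := key hN
  rw [ptB_sub, hPx, hNy]
  exact smul_add_smul_neg_mem (convex_convexHull ℝ _) (hmem hx).1 (hmem hy).2 hz hz'
    (trace_re_nonneg hP) (trace_re_nonneg hN) h

end Sets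

/-! ### The maximally entangled state and the swap operator -/

section MaximallyEntangled

/-- The operator exchanging the two tensor factors. -/
def swapOp (m : ℕ) : Op (Fin m × Fin m) :=
  Matrix.of fun p q => if p.1 = q.2 ∧ p.2 = q.1 then 1 else 0

theorem isHermitian_swapOp (m : ℕ) : (swapOp m).IsHermitian := by
  ext p q
  simp only [swapOp, conjTranspose_apply, of_apply]
  have : (q.1 = p.2 ∧ q.2 = p.1) ↔ (p.1 = q.2 ∧ p.2 = q.1) := by grind
  simp [this, apply_ite]

theorem swapOp_mul_swapOp (m : ℕ) : swapOp m * swapOp m = 1 := by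
  ext p q
  rw [Matrix.mul_apply, Finset.sum_eq_single (p.2, p.1)]
  · simp only [swapOp, of_apply, one_apply, Prod.ext_iff]
    simp [and_comm]
  · rintro ⟨b1, b2⟩ _ hb
    have : ¬ (p.1 = b2 ∧ p.2 = b1) := fun h => hb (by rw [h.1, h.2])
    simp [swapOp, this]
  · simp

/-- As F² = 1, the Hermitian operator 1 + F is half its own square. -/
theorem posSemidef_one_add_swapOp (m : ℕ) : (1 + swapOp m).PosSemidef := by
  have h := posSemidef_conjTranspose_mul_self (1 + swapOp m)
  rw [(isHermitian_one.add (isHermitian_swapOp m)).eq] at h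
  have h2 : (1 + swapOp m) * (1 + swapOp m) = (2 : ℝ) • (1 + swapOp m) := by
    rw [mul_add, add_mul, add_mul, swapOp_mul_swapOp, two_smul]
    simp only [one_mul, mul_one]
    abel
  have h3 := posSemidef_real_smul (h2 ▸ h) (r := 1 / 2) (by norm_num)
  rwa [smul_smul, one_div_mul_cancel two_ne_zero, one_smul] at h3

theorem posSemidef_one_sub_swapOp (m : ℕ) : (1 - swapOp m).PosSemidef := by
  have h := posSemidef_conjTranspose_mul_self (1 - swapOp m)
  rw [(isHermitian_one.sub (isHermitian_swapOp m)).eq] at h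
  have h2 : (1 - swapOp m) * (1 - swapOp m) = (2 : ℝ) • (1 - swapOp m) := by
    rw [mul_sub, sub_mul, sub_mul, swapOp_mul_swapOp, two_smul]
    simp only [one_mul, mul_one]
    abel
  have h3 := posSemidef_real_smul (h2 ▸ h) (r := 1 / 2) (by norm_num)
  rwa [smul_smul, one_div_mul_cancel two_ne_zero, one_smul] at h3

theorem maxEnt_apply (m : ℕ) (p q : Fin m × Fin m) :
    maxEnt m p q = if p.1 = p.2 ∧ q.1 = q.2 then ((m : ℝ)⁻¹ : ℂ) else 0 := by
  have h : ((Real.sqrt m : ℂ))⁻¹ * ((Real.sqrt m : ℂ))⁻¹ = ((m : ℝ) : ℂ)⁻¹ := by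
    rw [← mul_inv, ← Complex.ofReal_mul, Real.mul_self_sqrt (Nat.cast_nonneg m)]
  by_cases h1 : p.1 = p.2 <;> by_cases h2 : q.1 = q.2 <;>
    simp [maxEnt, maxEntVec, vecMulVec_apply, h1, h2, h]

theorem ptB_maxEnt (m : ℕ) : ptB (maxEnt m) = (m : ℝ)⁻¹ • swapOp m := by
  ext p q
  rw [ptB_apply, maxEnt_apply]
  have : (p.1 = q.2 ∧ q.1 = p.2) ↔ (p.1 = q.2 ∧ p.2 = q.1) := by grind
  by_cases h : p.1 = q.2 ∧ p.2 = q.1 <;> simp [this, h, swapOp]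

theorem posSemidef_maxEnt (m : ℕ) : (maxEnt m).PosSemidef := posSemidef_rankOne _

theorem trace_maxEnt {m : ℕ} (hm : 1 ≤ m) : (maxEnt m).trace = 1 := by
  have h : (m : ℂ) ≠ 0 := by exact_mod_cast (by omega : m ≠ 0)
  simp [trace, maxEnt_apply, Fintype.sum_prod_type, h]

theorem maxEnt_mul_maxEnt {m : ℕ} (hm : 1 ≤ m) : maxEnt m * maxEnt m = maxEnt m := by
  have h : star (maxEntVec m) ⬝ᵥ maxEntVec m = 1 := by
    rw [dotProduct_comm, ← trace_vecMulVec]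
    exact trace_maxEnt hm
  rw [maxEnt, vecMulVec_mul_vecMulVec, h]
  simp

theorem posSemidef_one_sub_maxEnt {m : ℕ} (hm : 1 ≤ m) : (1 - maxEnt m).PosSemidef := by
  have h := posSemidef_conjTranspose_mul_self (1 - maxEnt m)
  rw [(isHermitian_one.sub (posSemidef_maxEnt m).1).eq] at h
  have h2 : (1 - maxEnt m) * (1 - maxEnt m) = 1 - maxEnt m := by
    rw [mul_sub, sub_mul, sub_mul, maxEnt_mul_maxEnt hm]
    simp
  rwa [h2] at h

theorem hs_maxEnt_eq {m : ℕ} (X : Op (Fin m × Fin m)) :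
    hs (maxEnt m) X = (m : ℝ)⁻¹ * hs (swapOp m) (ptB X) := by
  rw [← hs_ptB (posSemidef_maxEnt m).1, ptB_maxEnt, hs_smul_left]

/-- Move the partial transposition onto Ψ_m, turning it into F/m, and use -1 ≤ F ≤ 1 against the
positive unit-trace operator X^{T_B}. -/
theorem abs_hs_maxEnt_le {m : ℕ} {X : Op (Fin m × Fin m)} (hX : X ∈ PPT (Fin m) (Fin m)) :
    |hs (maxEnt m) X| ≤ (m : ℝ)⁻¹ := by
  obtain ⟨_, htr, hpos⟩ := hX
  have h1 := hs_nonneg (posSemidef_one_add_swapOp m) hpos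
  have h2 := hs_nonneg (posSemidef_one_sub_swapOp m) hpos
  rw [hs_add_left, hs_one_left, trace_ptB, htr, Complex.one_re] at h1
  rw [hs_sub_left, hs_one_left, trace_ptB, htr, Complex.one_re] at h2
  rw [hs_maxEnt_eq, abs_mul, abs_inv, Nat.abs_cast]
  exact mul_le_of_le_one_right (by positivity) (abs_le.mpr ⟨by linarith, by linarith⟩)

end MaximallyEntangled

/-! ### Choi matrices, dual effects and measure-and-prepare channels -/

section Channels

variable {I J : Type*} [Fintype I] [Fintype J]

/-- Summing a positive semidefinite operator over all blocks preserves positivity. -/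
theorem posSemidef_blockSum {K : Type*} [Fintype K] {N : Op (J × K)} (hN : N.PosSemidef) :
    (Matrix.of fun p q => ∑ a, ∑ b, N (p, a) (q, b) : Op J).PosSemidef := by
  refine posSemidef_of_forall_nonneg fun v => ?_
  -- Extend the test vector to be constant in the summed index.
  convert hN.dotProduct_mulVec_nonneg (fun x => v x.1) using 1
  simp only [dotProduct, mulVec, Fintype.sum_prod_type, of_apply, Pi.star_apply]
  refine Finset.sum_congr rfl fun p _ => ?_
  rw [← Finset.mul_sum]
  congr 1
  rw [Finset.sum_comm]
  refine Finset.sum_congr rfl fun q _ => ?_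
  rw [Finset.sum_mul]
  simp only [Finset.sum_mul]

variable [DecidableEq I]

theorem superOp_apply_eq_sum (Λ : SuperOp I J) (X : Op I) (i j : J) :
    Λ X i j = ∑ a, ∑ b, X a b * choi Λ (a, i) (b, j) := by
  conv_lhs => rw [matrix_eq_sum_single X]
  simp only [map_sum, Matrix.sum_apply, choi, of_apply]
  refine Finset.sum_congr rfl fun a _ => Finset.sum_congr rfl fun b _ => ?_
  rw [show single a b (X a b) = X a b • single a b (1 : ℂ) by simp, map_smul]
  rfl

/-- The amplified output is a block sum of a principal reindexing of Z ⊗ J_Λ, and each of these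
operations keeps positivity. -/
theorem isCP_of_posSemidef_choi {Λ : SuperOp I J} (h : (choi Λ).PosSemidef) : IsCP Λ := by
  intro k Z hZ
  have h1 : ((Z ⊗ₖ choi Λ).submatrix
      (fun x : (Fin k × J) × I => ((x.1.1, x.2), (x.2, x.1.2)))
      (fun x : (Fin k × J) × I => ((x.1.1, x.2), (x.2, x.1.2)))).PosSemidef :=
    (hZ.kronecker h).submatrix _
  convert posSemidef_blockSum h1 using 1
  ext p q
  simp only [ampl, of_apply, superOp_apply_eq_sum Λ, submatrix_apply, kroneckerMap_apply]

theorem IsCP.posSemidef_apply {Λ : SuperOp I J} (h : IsCP Λ) {P : Op I} (hP : P.PosSemidef) :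
    (Λ P).PosSemidef :=
  (h 1 (P.submatrix Prod.snd Prod.snd) (hP.submatrix _)).submatrix fun j => ((0 : Fin 1), j)

/-- The effect obtained from `T` by a channel in the Heisenberg picture. -/
theorem IsCPTP.exists_dual_effect [DecidableEq J] {Λ : SuperOp I J} (h : IsCPTP Λ) {T : Op J}
    (hT : T.PosSemidef) (hT' : (1 - T).PosSemidef) :
    ∃ W : Op I, W.PosSemidef ∧ (1 - W).PosSemidef ∧ ∀ X, (W * X).trace = (T * Λ X).trace := by
  set W : Op I := Matrix.of fun b a => (T * Λ (single a b 1)).trace with hWdef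
  have hW (X : Op I) : (W * X).trace = (T * Λ X).trace := by
    conv_rhs => rw [matrix_eq_sum_single X]
    simp only [map_sum, Matrix.mul_sum, trace_sum]
    rw [trace, Finset.sum_comm]
    refine Finset.sum_congr rfl fun b _ => ?_
    rw [diag_apply, Matrix.mul_apply]
    refine Finset.sum_congr rfl fun a _ => ?_
    rw [show single a b (X a b) = X a b • single a b (1 : ℂ) by simp, map_smul, Matrix.mul_smul,
      trace_smul, smul_eq_mul, mul_comm, hWdef, of_apply]
  refine ⟨W, posSemidef_of_forall_nonneg fun v => ?_, posSemidef_of_forall_nonneg fun v => ?_, hW⟩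
  · rw [← trace_mul_rankOne, hW]
    exact PosSemidef.trace_mul_nonneg hT (h.1.posSemidef_apply (posSemidef_rankOne v))
  -- Trace preservation turns the pairing of 1 - T with the output into the pairing of 1 - W with
  -- the input.
  · have := PosSemidef.trace_mul_nonneg hT' (h.1.posSemidef_apply (posSemidef_rankOne v))
    rw [← trace_mul_rankOne]
    rwa [Matrix.sub_mul, trace_sub, Matrix.one_mul, hW, ← h.2, ← trace_sub, ← Matrix.one_mul (Λ _),
      ← Matrix.mul_assoc, Matrix.mul_one, ← Matrix.sub_mul]

/-- The map measuring the effect `W` and preparing `S` or `R` according to the outcome. -/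
def measurePrepare (W : Op I) (S R : Op J) : SuperOp I J where
  toFun X := (W * X).trace • S + ((1 - W) * X).trace • R
  map_add' X Y := by
    simp only [Matrix.mul_add, trace_add, add_smul]
    abel
  map_smul' c X := by
    simp only [Matrix.mul_smul, trace_smul, smul_eq_mul, mul_smul, smul_add, RingHom.id_apply]

theorem measurePrepare_apply (W : Op I) (S R : Op J) (X : Op I) :
    measurePrepare W S R X = (W * X).trace • S + ((1 - W) * X).trace • R := rfl

theorem trace_mul_single (W : Op I) (a b : I) : (W * single a b (1 : ℂ)).trace = W b a := by
  rw [trace_mul_comm, trace_single_mul, one_smul]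

theorem choi_measurePrepare (W : Op I) (S R : Op J) :
    choi (measurePrepare W S R) = Wᵀ ⊗ₖ S + (1 - W)ᵀ ⊗ₖ R := by
  ext p q
  simp only [choi, of_apply, measurePrepare_apply, trace_mul_single, Matrix.add_apply,
    Matrix.smul_apply, kroneckerMap_apply, transpose_apply, smul_eq_mul]

/-- The alternative W = 1 serves m = 1, where the second prepared operator degenerates to zero and
cannot have unit trace. -/
theorem isCPTP_measurePrepare {W : Op I} {S R : Op J} (hW : W.PosSemidef)
    (hW' : (1 - W).PosSemidef) (hS : S.PosSemidef) (hR : R.PosSemidef) (htS : S.trace = 1)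
    (htR : W = 1 ∨ R.trace = 1) : IsCPTP (measurePrepare W S R) := by
  refine ⟨isCP_of_posSemidef_choi ?_, fun X => ?_⟩
  · rw [choi_measurePrepare]
    exact (hW.transpose.kronecker hS).add (hW'.transpose.kronecker hR)
  · rw [measurePrepare_apply, trace_add, trace_smul, trace_smul, htS]
    rcases htR with rfl | htR
    · simp
    · rw [htR, Matrix.sub_mul, trace_sub, Matrix.one_mul]
      simp

end Channels

/-! ### PPT channels and isotropic outputs -/

section PPTChannels

variable {A B A' B' : Type*} [Fintype A] [DecidableEq A] [Fintype B] [DecidableEq B]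
  [Fintype A'] [DecidableEq A'] [Fintype B'] [DecidableEq B']

/-- Conjugation of a map by the partial transpositions on its input and output. -/
def conjPtB (Λ : SuperOp (A × B) (A' × B')) : SuperOp (A × B) (A' × B') where
  toFun X := ptB (Λ (ptB X))
  map_add' X Y := by rw [ptB_add, map_add, ptB_add]
  map_smul' c X := by rw [ptB_smul, map_smul, ptB_smul, RingHom.id_apply]

theorem choi_conjPtB (Λ : SuperOp (A × B) (A' × B')) : choi (conjPtB Λ) = ptBB' (choi Λ) := by
  ext p q
  change ptB (Λ (ptB (single p.1 q.1 1))) p.2 q.2 = _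
  rw [ptB_single]
  rfl

/-- The partially transposed Choi matrix is the Choi matrix of the map conjugated by partial
transpositions, so that map is positive and sends X^{T_B} to Λ(X)^{T_B'}. -/
theorem PPTops_subset_PPTpres : PPTops A B A' B' ⊆ PPTpres A B A' B' := by
  rintro Λ ⟨hΛ, hJ⟩
  refine ⟨hΛ, fun X ⟨_, htr, hpos⟩ => ?_⟩
  rw [← choi_conjPtB] at hJ
  have h : (ptB (Λ X)).PosSemidef := (isCP_of_posSemidef_choi hJ).posSemidef_apply hpos
  exact ⟨isHermitian_of_ptB h.1, by rw [hΛ.2, htr], h⟩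

theorem ptBB'_add (J K : Op ((A × B) × (A' × B'))) : ptBB' (J + K) = ptBB' J + ptBB' K := rfl

theorem ptBB'_kronecker (X : Op (A × B)) (Y : Op (A' × B')) :
    ptBB' (X ⊗ₖ Y) = ptB X ⊗ₖ ptB Y := rfl

/-- The normalized projector onto the orthogonal complement of the maximally entangled vector. -/
noncomputable def coMaxEnt (m : ℕ) : Op (Fin m × Fin m) := ((m : ℝ) ^ 2 - 1)⁻¹ • (1 - maxEnt m)

theorem posSemidef_coMaxEnt {m : ℕ} (hm : 1 ≤ m) : (coMaxEnt m).PosSemidef := by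
  refine posSemidef_real_smul (posSemidef_one_sub_maxEnt hm) (inv_nonneg.mpr ?_)
  have : (1 : ℝ) ≤ m := by exact_mod_cast hm
  nlinarith

theorem trace_coMaxEnt {m : ℕ} (hm : 2 ≤ m) : (coMaxEnt m).trace = 1 := by
  have h : (m : ℝ) ^ 2 - 1 ≠ 0 := by
    have : (2 : ℝ) ≤ m := by exact_mod_cast hm
    nlinarith
  rw [coMaxEnt, trace_smul, trace_sub, trace_maxEnt (by omega), trace_one, Complex.real_smul]
  have h2 : ((Fintype.card (Fin m × Fin m) : ℕ) : ℂ) - 1 = (((m : ℝ) ^ 2 - 1 : ℝ) : ℂ) := by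
    simp [sq]
  rw [h2, ← Complex.ofReal_mul, inv_mul_cancel₀ h, Complex.ofReal_one]

theorem ptB_coMaxEnt (m : ℕ) :
    ptB (coMaxEnt m) = ((m : ℝ) ^ 2 - 1)⁻¹ • (1 - (m : ℝ)⁻¹ • swapOp m) := by
  rw [coMaxEnt, ptB_smul, ptB_sub, ptB_one, ptB_maxEnt]

/-- Spectral splitting along the projectors (1 ± F)/2: putting F = ±1 on the left gives the
coefficients (1 + mw)/(m(m + 1)) and (1 - mw)/(m(m - 1)). -/
theorem kronecker_isotropic {K : Type*} [DecidableEq K] {m : ℕ} (hm : 2 ≤ m) (w : Op K) :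
    w ⊗ₖ ((m : ℝ)⁻¹ • swapOp m) +
        (1 - w) ⊗ₖ (((m : ℝ) ^ 2 - 1)⁻¹ • (1 - (m : ℝ)⁻¹ • swapOp m)) =
      (2 * m * (m + 1) : ℝ)⁻¹ • ((1 + (m : ℝ) • w) ⊗ₖ (1 + swapOp m)) +
        (2 * m * (m - 1) : ℝ)⁻¹ • ((1 - (m : ℝ) • w) ⊗ₖ (1 - swapOp m)) := by
  have hm' : (2 : ℝ) ≤ m := by exact_mod_cast hm
  have h0 : (m : ℂ) ≠ 0 := by exact_mod_cast (by omega : m ≠ 0)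
  have h1 : (m : ℂ) - 1 ≠ 0 := by
    have : ((m : ℝ) - 1) ≠ 0 := by linarith
    exact_mod_cast this
  have h2 : (m : ℂ) + 1 ≠ 0 := by exact_mod_cast (by omega : m + 1 ≠ 0)
  have h3 : (m : ℂ) ^ 2 - 1 = (m - 1) * (m + 1) := by ring
  ext p q
  simp only [Matrix.add_apply, Matrix.sub_apply, Matrix.smul_apply, kroneckerMap_apply,
    Complex.real_smul]
  generalize w p.1 q.1 = x
  generalize swapOp m p.2 q.2 = s
  generalize (1 : Op K) p.1 q.1 = e
  generalize (1 : Op (Fin m × Fin m)) p.2 q.2 = f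
  push_cast
  rw [h3]
  field_simp
  ring

theorem posSemidef_kronecker_isotropic {K : Type*} [Fintype K] [DecidableEq K] {m : ℕ}
    (hm : 2 ≤ m) {w : Op K} (h1 : (1 + (m : ℝ) • w).PosSemidef)
    (h2 : (1 - (m : ℝ) • w).PosSemidef) :
    (w ⊗ₖ ptB (maxEnt m) + (1 - w) ⊗ₖ ptB (coMaxEnt m)).PosSemidef := by
  have hm' : (2 : ℝ) ≤ m := by exact_mod_cast hm
  rw [ptB_maxEnt, ptB_coMaxEnt, kronecker_isotropic hm]
  refine (posSemidef_real_smul (h1.kronecker (posSemidef_one_add_swapOp m)) ?_).add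
    (posSemidef_real_smul (h2.kronecker (posSemidef_one_sub_swapOp m)) ?_)
  · positivity
  · have : (0 : ℝ) ≤ m - 1 := by linarith
    positivity

/-- The scalar case, read off from the operator version over a one-dimensional space. -/
theorem posSemidef_isotropic {m : ℕ} (hm : 2 ≤ m) {t : ℝ} (h1 : 0 ≤ 1 + m * t)
    (h2 : 0 ≤ 1 - m * t) : (t • ptB (maxEnt m) + (1 - t) • ptB (coMaxEnt m)).PosSemidef := by
  have h (r : ℝ) (hr : 0 ≤ r) : (r • (1 : Op Unit)).PosSemidef :=
    posSemidef_real_smul PosSemidef.one hr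
  have key := posSemidef_kronecker_isotropic (w := t • (1 : Op Unit)) hm
    (by convert h _ h1 using 1; rw [add_smul, one_smul, mul_smul])
    (by convert h _ h2 using 1; rw [sub_smul, one_smul, mul_smul])
  convert key.submatrix (fun p => ((), p)) using 1
  ext p q
  simp

theorem maxEnt_mem_PPTplus_one : maxEnt 1 ∈ PPTplus (Fin 1) (Fin 1) := by
  refine ⟨(posSemidef_maxEnt 1).1, trace_maxEnt le_rfl, posSemidef_maxEnt 1, ?_⟩
  have : ptB (maxEnt 1) = maxEnt 1 := by
    ext p q
    rw [ptB_apply, Subsingleton.elim (p.1, q.2) p, Subsingleton.elim (q.1, p.2) q]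
  rw [this]
  exact posSemidef_maxEnt 1

end PPTChannels

/-! ### The optimisation defining G and its attainment -/

section Feasible

variable {I : Type*} [Fintype I] [DecidableEq I]

/-- The effects over which the supremum `G m Q` is taken. -/
def feasible (m : ℕ) (Q : Set (Op I)) : Set (Op I) :=
  {W | (W.PosSemidef ∧ (1 - W).PosSemidef) ∧ ∀ X ∈ Q, m * hs W X ≤ 1}

theorem G_eq_sSup_image {m : ℕ} (hm : 1 ≤ m) (Q : Set (Op I)) (ρ : Op I) :
    G m Q ρ = sSup (hs ρ '' feasible m Q) := by
  have h0 : (m : ℝ) ≠ 0 := by exact_mod_cast (by omega : m ≠ 0)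
  unfold G
  congr 1
  ext r
  constructor
  · rintro ⟨W, h1, h2, h3, rfl⟩
    rw [Set.mem_inv_smul_set_iff₀ h0] at h3
    exact ⟨W, ⟨⟨h1, h2⟩, fun X hX => by rw [← hs_smul_left]; exact h3.2 X hX⟩, rfl⟩
  · rintro ⟨W, ⟨⟨h1, h2⟩, h3⟩, rfl⟩
    refine ⟨W, h1, h2, ?_, rfl⟩
    rw [Set.mem_inv_smul_set_iff₀ h0]
    refine ⟨(posSemidef_real_smul h1 (Nat.cast_nonneg m)).1, fun X hX => ?_⟩
    rw [hs_smul_left]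
    exact h3 X hX

theorem continuous_hs_left (X : Op I) : Continuous fun W => hs W X := by
  unfold hs
  fun_prop

theorem continuous_hs_right (W : Op I) : Continuous (hs W) := by
  unfold hs
  fun_prop

theorem isCompact_feasible (m : ℕ) (Q : Set (Op I)) : IsCompact (feasible m Q) := by
  refine isCompact_effects.inter_right ?_
  have : {W : Op I | ∀ X ∈ Q, m * hs W X ≤ 1} = ⋂ X ∈ Q, {W | m * hs W X ≤ 1} := by
    ext W
    simp
  change IsClosed {W : Op I | ∀ X ∈ Q, m * hs W X ≤ 1}
  rw [this]
  exact isClosed_biInter fun X _ =>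
    isClosed_le ((continuous_hs_left X).const_mul _) continuous_const

theorem zero_mem_feasible (m : ℕ) (Q : Set (Op I)) : (0 : Op I) ∈ feasible m Q :=
  ⟨⟨PosSemidef.zero, by rw [sub_zero]; exact PosSemidef.one⟩, fun X _ => by
    rw [hs_zero_left, mul_zero]; exact zero_le_one⟩

/-- The feasible effects are compact and include 0, so the supremum is a maximum and lower bounds on
it have witnesses. -/
theorem le_G_iff {m : ℕ} (hm : 1 ≤ m) {Q : Set (Op I)} {ρ : Op I} {c : ℝ} :
    c ≤ G m Q ρ ↔ ∃ W ∈ feasible m Q, c ≤ hs ρ W := by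
  have hK := (isCompact_feasible m Q).image (continuous_hs_right ρ)
  rw [G_eq_sSup_image hm]
  constructor
  · intro h
    obtain ⟨W, hW, hW'⟩ := hK.sSup_mem ⟨_, 0, zero_mem_feasible m Q, rfl⟩
    exact ⟨W, hW, hW' ▸ h⟩
  · rintro ⟨W, hW, h⟩
    exact h.trans (le_csSup hK.bddAbove ⟨W, hW, rfl⟩)

end Feasible

/-! ### Hypothesis testing and minimax -/

section HypothesisTesting

variable {I : Type*} [Fintype I] [DecidableEq I]

/-- The effects detecting `ρ` with error at most `ε`. -/
def tests (ε : ℝ) (ρ : Op I) : Set (Op I) :=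
  {M | (M.PosSemidef ∧ (1 - M).PosSemidef) ∧ 1 - hs M ρ ≤ ε}

theorem DH_eq (ε : ℝ) (ρ X : Op I) :
    DH ε ρ X = -log2 (sInf ((fun M => hs M X) '' tests ε ρ)) := by
  unfold DH
  congr 3
  ext r
  constructor
  · rintro ⟨M, h1, h2, h3, rfl⟩
    exact ⟨M, ⟨⟨h1, h2⟩, h3⟩, rfl⟩
  · rintro ⟨M, ⟨⟨h1, h2⟩, h3⟩, rfl⟩
    exact ⟨M, h1, h2, h3, rfl⟩

theorem isCompact_tests (ε : ℝ) (ρ : Op I) : IsCompact (tests ε ρ) :=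
  isCompact_effects.inter_right
    (isClosed_le (continuous_const.sub (continuous_hs_left ρ)) continuous_const)

theorem convex_tests (ε : ℝ) (ρ : Op I) : Convex ℝ (tests ε ρ) := by
  refine convex_effects.inter ?_
  intro M hM N hN a b ha hb hab
  change 1 - hs M ρ ≤ ε at hM
  change 1 - hs N ρ ≤ ε at hN
  change 1 - hs (a • M + b • N) ρ ≤ ε
  rw [hs_add_left, hs_smul_left, hs_smul_left]
  obtain rfl : b = 1 - a := by linarith
  nlinarith

theorem one_mem_tests {ε : ℝ} (hε : 0 ≤ ε) {ρ : Op I} (hρ : IsState ρ) : 1 ∈ tests ε ρ :=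
  ⟨⟨PosSemidef.one, by rw [sub_self]; exact PosSemidef.zero⟩, by
    rw [hs_one_left, hρ.2, Complex.one_re, sub_self]; exact hε⟩

theorem log2_mono : Monotone log2 := by
  intro x y hxy
  unfold log2
  split_ifs with hx hy hy
  · exact le_rfl
  · exact bot_le
  · exact absurd (hxy.trans hy) hx
  · exact EReal.coe_le_coe_iff.mpr
      (Real.logb_le_logb_of_le one_lt_two (not_le.mp hx) hxy)

theorem bddBelow_tests (ε : ℝ) (ρ X : Op I) : BddBelow ((fun M => hs M X) '' tests ε ρ) :=
  ((isCompact_tests ε ρ).image (continuous_hs_left X)).bddBelow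

theorem convexOn_hs_left {K : Set (Op I)} (hK : Convex ℝ K) (X : Op I) :
    ConvexOn ℝ K fun M => hs M X :=
  ⟨hK, fun M _ N _ a b _ _ _ => by
    dsimp only
    rw [hs_add_left, hs_smul_left, hs_smul_left, smul_eq_mul, smul_eq_mul]⟩

theorem concaveOn_hs_right {K : Set (Op I)} (hK : Convex ℝ K) (M : Op I) :
    ConcaveOn ℝ K fun X => hs M X :=
  ⟨hK, fun X _ Y _ a b _ _ _ => by
    dsimp only
    rw [hs_add_right, hs_smul_right, hs_smul_right, smul_eq_mul, smul_eq_mul]⟩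

/-- The minimax theorem for hypothesis testing against a compact convex set of operators. -/
theorem exists_minimax_DH {Q : Set (Op I)} (hQ : IsCompact Q) (hQ' : Convex ℝ Q)
    (hone : ∀ X ∈ Q, hs 1 X ≤ 1) {X₀ : Op I} (hX₀ : X₀ ∈ Q)
    (hpos : ∀ M : Op I, M.PosSemidef → M ≠ 0 → 0 < hs M X₀)
    {ρ : Op I} (hρ : IsState ρ) {ε : ℝ} (h0 : 0 ≤ ε) (h1 : ε < 1) :
    ∃ v : ℝ, 0 < v ∧ v ≤ 1 ∧ IsLeast (DH ε ρ '' Q) (-log2 v) ∧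
      ∀ m : ℕ, 1 ≤ m → (1 - ε ≤ G m Q ρ ↔ m * v ≤ 1) := by
  obtain ⟨M, hM, X, hX, hMX⟩ := Sion.exists_isSaddlePointOn (f := hs)
    ⟨1, one_mem_tests h0 hρ⟩ (convex_tests ε ρ) (isCompact_tests ε ρ)
    (fun X _ => (continuous_hs_left X).continuousOn.lowerSemicontinuousOn)
    (fun X _ => (convexOn_hs_left (convex_tests ε ρ) X).quasiconvexOn)
    hQ' ⟨X₀, hX₀⟩ hQ
    (fun M _ => (continuous_hs_right M).continuousOn.upperSemicontinuousOn)
    (fun M _ => (concaveOn_hs_right hQ' M).quasiconcaveOn)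
  -- The zero effect has error 1, which ε < 1 forbids; this is what makes the saddle value positive.
  have hM0 : M ≠ 0 := by
    rintro rfl
    have := hM.2
    rw [hs_zero_left] at this
    linarith
  have hinf : IsLeast ((fun M => hs M X) '' tests ε ρ) (hs M X) :=
    ⟨⟨M, hM, rfl⟩, by rintro _ ⟨N, hN, rfl⟩; exact hMX N hN X hX⟩
  -- The saddle value is bounded below by comparison with `X₀` and above by comparison with the
  -- trivial test 1.
  refine ⟨hs M X, (hpos M hM.1.1 hM0).trans_le (hMX M hM X₀ hX₀),
    (hMX 1 (one_mem_tests h0 hρ) X hX).trans (hone X hX), ⟨⟨X, hX, ?_⟩, ?_⟩, fun m hm => ?_⟩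
  · rw [DH_eq, hinf.csInf_eq]
  · rintro _ ⟨Y, hY, rfl⟩
    rw [DH_eq]
    exact EReal.neg_le_neg_iff.mpr (log2_mono
      ((csInf_le (bddBelow_tests ε ρ Y) ⟨M, hM, rfl⟩).trans (hMX M hM Y hY)))
  -- A feasible effect reaching 1 - ε is a test, so its pairing with the saddle operator is at least
  -- v; conversely the saddle test is itself feasible once mv ≤ 1.
  · rw [le_G_iff hm]
    constructor
    · rintro ⟨W, hW, hWρ⟩
      have hW' : W ∈ tests ε ρ := ⟨hW.1, by rw [hs_comm]; linarith⟩
      exact (mul_le_mul_of_nonneg_left (hMX W hW' X hX) (Nat.cast_nonneg m)).trans (hW.2 X hX)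
    · intro h
      refine ⟨M, ⟨hM.1, fun Y hY => ?_⟩, ?_⟩
      · exact (mul_le_mul_of_nonneg_left (hMX M hM Y hY) (Nat.cast_nonneg m)).trans h
      · have := hM.2
        rw [hs_comm]
        linarith

end HypothesisTesting

/-! ### From fidelities to one-shot distillable entanglement -/

section OneShot

variable {A B : Type*} [Fintype A] [DecidableEq A] [Fintype B] [DecidableEq B]

theorem logFloor_neg_log2 {v : ℝ} (hv : 0 < v) : logFloor (-log2 v) = log2 (⌊v⁻¹⌋₊ : ℝ) := by
  have h : -log2 v = ((-Real.logb 2 v : ℝ) : EReal) := by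
    rw [log2, if_neg (not_le.mpr hv), EReal.coe_neg]
  rw [h, logFloor, if_neg (EReal.coe_ne_top _), if_neg (EReal.coe_ne_bot _), EReal.toReal_coe,
    Real.rpow_neg zero_le_two, Real.rpow_logb two_pos (by norm_num) hv,
    natCast_floor_eq_intCast_floor (inv_nonneg.mpr hv.le)]

/-- For natural m, mv ≤ 1 means m ≤ ⌊1/v⌋; the bound v ≤ 1 keeps this floor at least 1, as
achievability requires. -/
theorem isGreatest_achievable {O : OpClass A B} {ε : ℝ} {ρ : Op (A × B)} {v : ℝ} (hv : 0 < v)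
    (hv1 : v ≤ 1) (h : ∀ m : ℕ, 1 ≤ m → (1 - ε ≤ Fid O ρ m ↔ m * v ≤ 1)) :
    IsGreatest (achievable O ε ρ) ⌊v⁻¹⌋₊ := by
  have hle (m : ℕ) : m * v ≤ 1 ↔ m ≤ ⌊v⁻¹⌋₊ := by
    rw [Nat.le_floor_iff (inv_nonneg.mpr hv.le), ← one_div, le_div_iff₀ hv]
  have h1 : 1 ≤ ⌊v⁻¹⌋₊ := (hle 1).mp (by simpa using hv1)
  exact ⟨⟨h1, (h _ h1).mpr ((hle _).mpr le_rfl)⟩,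
    fun m hm => (hle m).mp ((h m hm.1).mp hm.2)⟩

theorem Edist_eq_of_isGreatest {O : OpClass A B} {ε : ℝ} {ρ : Op (A × B)} {N : ℕ}
    (h : IsGreatest (achievable O ε ρ) N) : Edist O ε ρ = log2 N :=
  le_antisymm (iSup₂_le fun _ hm => log2_mono (Nat.cast_le.mpr (h.2 hm)))
    (le_iSup₂ (f := fun (m : ℕ) (_ : m ∈ achievable O ε ρ) => log2 (m : ℝ)) N h.1)

theorem Edist_eq_top {O : OpClass A B} {ε : ℝ} {ρ : Op (A × B)}
    (h : ∀ m : ℕ, 1 ≤ m → m ∈ achievable O ε ρ) : Edist O ε ρ = ⊤ := by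
  refine EReal.eq_top_iff_forall_lt _ |>.mpr fun y => ?_
  obtain ⟨n, hn⟩ := exists_nat_gt ((2 : ℝ) ^ y)
  have hn0 : (0 : ℝ) < n := (Real.rpow_pos_of_pos two_pos y).trans hn
  have hlt : (y : EReal) < log2 n := by
    rw [log2, if_neg (not_le.mpr hn0), EReal.coe_lt_coe_iff]
    exact (Real.lt_logb_iff_rpow_lt one_lt_two hn0).mpr hn
  exact hlt.trans_le (le_iSup₂ (f := fun (m : ℕ) (_ : m ∈ achievable O ε ρ) => log2 (m : ℝ)) n
    (h n (by exact_mod_cast hn0)))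

theorem Edist_congr {O O' : OpClass A B} {ρ : Op (A × B)} (ε : ℝ)
    (h : ∀ m : ℕ, 1 ≤ m → Fid O ρ m = Fid O' ρ m) : Edist O ε ρ = Edist O' ε ρ := by
  have : achievable O ε ρ = achievable O' ε ρ := by
    ext m
    exact and_congr_right fun hm => by rw [h m hm]
  rw [Edist, this, Edist]

/-- At full error the zero test is allowed, so the infimum is nonpositive and the logarithm takes
its conventional value -∞. -/
theorem DH_one_eq_top (ρ X : Op (A × B)) : DH 1 ρ X = ⊤ := by
  have h0 : (0 : Op (A × B)) ∈ tests 1 ρ :=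
    ⟨⟨PosSemidef.zero, by rw [sub_zero]; exact PosSemidef.one⟩, by rw [hs_zero_left, sub_zero]⟩
  have h : sInf ((fun M => hs M X) '' tests 1 ρ) ≤ 0 :=
    csInf_le (bddBelow_tests 1 ρ X) ⟨0, h0, hs_zero_left X⟩
  rw [DH_eq, log2, if_pos h, EReal.neg_bot]

theorem Edist_eq_logFloor {Q : Set (Op (A × B))} (hQ : IsCompact Q) (hQ' : Convex ℝ Q)
    (hone : ∀ X ∈ Q, hs 1 X ≤ 1) {X₀ : Op (A × B)} (hX₀ : X₀ ∈ Q)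
    (hpos : ∀ M : Op (A × B), M.PosSemidef → M ≠ 0 → 0 < hs M X₀)
    {ρ : Op (A × B)} (hρ : IsState ρ) {O : OpClass A B}
    (hO : ∀ m : ℕ, 1 ≤ m → Fid O ρ m = G m Q ρ) {ε : ℝ} (h0 : 0 ≤ ε) (h1 : ε ≤ 1) :
    ∃ t : EReal, IsLeast (DH ε ρ '' Q) t ∧ Edist O ε ρ = logFloor t := by
  rcases h1.eq_or_lt with rfl | h1
  · refine ⟨⊤, ⟨⟨X₀, hX₀, DH_one_eq_top ρ X₀⟩, ?_⟩, ?_⟩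
    · rintro _ ⟨X, _, rfl⟩
      rw [DH_one_eq_top]
    · rw [logFloor, if_pos rfl]
      refine Edist_eq_top fun m hm => ⟨hm, ?_⟩
      rw [hO m hm, le_G_iff hm, sub_self]
      exact ⟨0, zero_mem_feasible m Q, (hs_zero_right ρ).ge⟩
  · obtain ⟨v, hv, hv1, hleast, hG⟩ := exists_minimax_DH hQ hQ' hone hX₀ hpos hρ h0 h1
    refine ⟨_, hleast, ?_⟩
    rw [logFloor_neg_log2 hv]
    exact Edist_eq_of_isGreatest
      (isGreatest_achievable hv hv1 fun m hm => by rw [hO m hm]; exact hG m hm)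

theorem exists_isGreatest_achievable {Q : Set (Op (A × B))} (hQ : IsCompact Q)
    (hQ' : Convex ℝ Q) (hone : ∀ X ∈ Q, hs 1 X ≤ 1) {X₀ : Op (A × B)} (hX₀ : X₀ ∈ Q)
    (hpos : ∀ M : Op (A × B), M.PosSemidef → M ≠ 0 → 0 < hs M X₀)
    {ρ : Op (A × B)} (hρ : IsState ρ) {O : OpClass A B}
    (hO : ∀ m : ℕ, 1 ≤ m → Fid O ρ m = G m Q ρ) {ε : ℝ} (h0 : 0 ≤ ε) (h1 : ε < 1) :
    ∃ N : ℕ, IsGreatest (achievable O ε ρ) N := by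
  obtain ⟨v, hv, hv1, _, hG⟩ := exists_minimax_DH hQ hQ' hone hX₀ hpos hρ h0 h1
  exact ⟨_, isGreatest_achievable hv hv1 fun m hm => by rw [hO m hm]; exact hG m hm⟩

end OneShot

/-! ### Fidelity of distillation for the three classes -/

section Fidelity

variable {A B : Type*} [Fintype A] [DecidableEq A] [Fintype B] [DecidableEq B]

/-- Achievability is asked only as an inequality because the channel used for m = 1 ignores the
effect and may overshoot it. -/
theorem Fid_eq_G {O : OpClass A B} {Q : Set (Op (A × B))} {ρ : Op (A × B)} {m : ℕ} (hm : 1 ≤ m)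
    (h1 : ∀ Λ ∈ O m, ∃ W ∈ feasible m Q, hs (Λ ρ) (maxEnt m) = hs ρ W)
    (h2 : ∀ W ∈ feasible m Q, ∃ Λ ∈ O m, hs ρ W ≤ hs (Λ ρ) (maxEnt m)) :
    Fid O ρ m = G m Q ρ := by
  -- The zero effect yields some channel in the class, so the real supremum is over a nonempty set.
  obtain ⟨Λ₀, hΛ₀, -⟩ := h2 0 (zero_mem_feasible m Q)
  have hle : ∀ r ∈ {r | ∃ Λ ∈ O m, r = hs (Λ ρ) (maxEnt m)}, r ≤ G m Q ρ := by
    rintro _ ⟨Λ, hΛ, rfl⟩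
    obtain ⟨W, hW, h⟩ := h1 Λ hΛ
    exact (le_G_iff hm).mpr ⟨W, hW, h.le⟩
  refine le_antisymm (csSup_le ⟨_, Λ₀, hΛ₀, rfl⟩ hle) ?_
  obtain ⟨W, hW, h⟩ := (le_G_iff hm).mp (le_refl (G m Q ρ))
  obtain ⟨Λ, hΛ, h'⟩ := h2 W hW
  exact h.trans (h'.trans (le_csSup ⟨_, hle⟩ ⟨Λ, hΛ, rfl⟩))

/-- The effect detecting `maxEnt m` at the output of a channel. -/
theorem exists_effect_of_isCPTP {m : ℕ} (hm : 1 ≤ m) {Λ : SuperOp (A × B) (Fin m × Fin m)}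
    (hΛ : IsCPTP Λ) : ∃ W : Op (A × B), (W.PosSemidef ∧ (1 - W).PosSemidef) ∧
      ∀ X, hs W X = hs (maxEnt m) (Λ X) := by
  obtain ⟨W, h1, h2, h3⟩ := hΛ.exists_dual_effect (posSemidef_maxEnt m)
    (posSemidef_one_sub_maxEnt hm)
  refine ⟨W, ⟨h1, h2⟩, fun X => ?_⟩
  rw [hs_of_isHermitian h1.1, h3, hs_of_isHermitian (posSemidef_maxEnt m).1]

theorem hs_measurePrepare {m : ℕ} (hm : 1 ≤ m) {W X : Op (A × B)} (hW : W.IsHermitian)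
    (hX : X.IsHermitian) :
    hs (measurePrepare W (maxEnt m) (coMaxEnt m) X) (maxEnt m) = hs W X := by
  have h1 : (maxEnt m * coMaxEnt m).trace = 0 := by
    rw [coMaxEnt, Matrix.mul_smul, mul_sub, maxEnt_mul_maxEnt hm, mul_one, sub_self, smul_zero,
      trace_zero]
  rw [hs_comm, hs_of_isHermitian (posSemidef_maxEnt m).1, measurePrepare_apply, mul_add,
    Matrix.mul_smul, Matrix.mul_smul, trace_add, trace_smul, trace_smul, h1,
    maxEnt_mul_maxEnt hm, trace_maxEnt hm, trace_mul_eq_hs hW hX]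
  simp

theorem isCPTP_measurePrepare_maxEnt {m : ℕ} (hm : 1 ≤ m) {W : Op (A × B)} (hW : W.PosSemidef)
    (hW' : (1 - W).PosSemidef) (h : W = 1 ∨ 2 ≤ m) :
    IsCPTP (measurePrepare W (maxEnt m) (coMaxEnt m)) :=
  isCPTP_measurePrepare hW hW' (posSemidef_maxEnt m) (posSemidef_coMaxEnt hm) (trace_maxEnt hm)
    (h.imp_right trace_coMaxEnt)

theorem measurePrepare_one_apply {I J : Type*} [Fintype I] [DecidableEq I] [Fintype J]
    (S R : Op J) (X : Op I) : measurePrepare 1 S R X = X.trace • S := by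
  rw [measurePrepare_apply, sub_self, Matrix.zero_mul, trace_zero, zero_smul, add_zero,
    Matrix.one_mul]

theorem ptB_maxEnt_one_posSemidef : (ptB (maxEnt 1)).PosSemidef := maxEnt_mem_PPTplus_one.2.2.2

theorem hs_le_one_of_effect {W ρ : Op (A × B)} (hW : (1 - W).PosSemidef) (hρ : IsState ρ) :
    hs ρ W ≤ 1 := by
  rw [hs_comm]
  refine (hs_le_trace hW hρ.1).trans ?_
  rw [hρ.2, Complex.one_re]

theorem Fid_PPTplusPres {ρ : Op (A × B)} (hρ : IsState ρ) {m : ℕ} (hm : 1 ≤ m) :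
    Fid (fun k => PPTplusPres A B (Fin k) (Fin k)) ρ m = G m (PPTplus A B) ρ := by
  have hm0 : (0 : ℝ) < m := by exact_mod_cast hm
  refine Fid_eq_G hm (fun Λ ⟨hΛ, hpres⟩ => ?_) (fun W ⟨⟨hW, hW'⟩, hQ⟩ => ?_)
  · obtain ⟨W, hW, h⟩ := exists_effect_of_isCPTP hm hΛ
    refine ⟨W, ⟨hW, fun X hX => ?_⟩, by rw [hs_comm, ← h, hs_comm]⟩
    have := (le_abs_self _).trans (abs_hs_maxEnt_le (PPTplus_subset_PPT (hpres X hX)))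
    rw [h]
    calc (m : ℝ) * hs (maxEnt m) (Λ X) ≤ m * (m : ℝ)⁻¹ := mul_le_mul_of_nonneg_left this hm0.le
      _ = 1 := mul_inv_cancel₀ hm0.ne'
  -- For m = 1 the complementary state is zero; always preparing Ψ_1 already has fidelity one.
  · rcases hm.eq_or_lt with rfl | hm2
    · refine ⟨measurePrepare 1 (maxEnt 1) (coMaxEnt 1),
        ⟨isCPTP_measurePrepare_maxEnt le_rfl PosSemidef.one
          (by rw [sub_self]; exact PosSemidef.zero) (Or.inl rfl), fun X hX => ?_⟩, ?_⟩
      · rw [measurePrepare_one_apply, hX.2.1, one_smul]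
        exact maxEnt_mem_PPTplus_one
      · rw [hs_measurePrepare le_rfl isHermitian_one hρ.1.1, hs_one_left, hρ.2, Complex.one_re]
        exact hs_le_one_of_effect hW' hρ
    · have hΛ := isCPTP_measurePrepare_maxEnt hm hW hW' (Or.inr hm2)
      refine ⟨_, ⟨hΛ, fun X hX => ?_⟩, by rw [hs_measurePrepare hm hW.1 hρ.1.1, hs_comm]⟩
      have hpos := hΛ.1.posSemidef_apply hX.2.2.1
      refine ⟨hpos.1, by rw [hΛ.2, hX.2.1], hpos, ?_⟩
      have ht := hs_nonneg hW hX.2.2.1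
      have ht' := hQ X hX
      -- The lower bound is free because W and X are both positive; only the upper one needs the
      -- polar constraint.
      convert posSemidef_isotropic hm2 (t := hs W X) (by positivity) (by linarith) using 1
      rw [measurePrepare_apply, trace_mul_eq_hs hW.1 hX.1,
        trace_mul_eq_hs (isHermitian_one.sub hW.1) hX.1, hs_sub_left, hs_one_left, hX.2.1,
        Complex.one_re, ptB_add, ptB_smul, ptB_smul]
      rfl

/-- A Hermitian operator of expectation at most one on `PPTprime` has partial transpose between
`-1` and `1`. -/
theorem posSemidef_one_add_sub_ptB {H : Op (A × B)} (hH : H.IsHermitian)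
    (h : ∀ X ∈ PPTprime A B, hs H X ≤ 1) :
    (1 + ptB H).PosSemidef ∧ (1 - ptB H).PosSemidef := by
  have hst {P : Op (A × B)} (hP : P.PosSemidef) (htr : P.trace = 1) : ptB P ∈ PPT A B :=
    ⟨isHermitian_ptB hP.1, htr, hP⟩
  constructor
  · rw [← sub_neg_eq_add]
    refine posSemidef_one_sub_of_forall_hs_le (isHermitian_ptB hH).neg fun P hP htr => ?_
    have := h (-ptB P) (neg_PPT_subset_PPTprime (by
      rw [Set.mem_neg, neg_neg]; exact hst hP htr))
    rwa [← hs_ptB hH, ptB_neg, ptB_ptB, hs_neg_right, ← hs_neg_left] at this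
  · refine posSemidef_one_sub_of_forall_hs_le (isHermitian_ptB hH) fun P hP htr => ?_
    have := h (ptB P) (PPT_subset_PPTprime (hst hP htr))
    rwa [← hs_ptB hH, ptB_ptB] at this

/-- The swap bound is two-sided, so the constraint on the dual effect holds on PPT and on -PPT,
hence on their convex hull PPT'. -/
theorem exists_feasible_of_mem_PPTpres [Nonempty A] [Nonempty B] {ρ : Op (A × B)} {m : ℕ}
    (hm : 1 ≤ m) {Λ : SuperOp (A × B) (Fin m × Fin m)} (hΛ : Λ ∈ PPTpres A B (Fin m) (Fin m)) :
    ∃ W ∈ feasible m (PPTprime A B), hs (Λ ρ) (maxEnt m) = hs ρ W := by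
  have hm0 : (0 : ℝ) < m := by exact_mod_cast hm
  obtain ⟨W, hW, h⟩ := exists_effect_of_isCPTP hm hΛ.1
  refine ⟨W, ⟨hW, fun X hX => ?_⟩, by rw [hs_comm, ← h, hs_comm]⟩
  have key (X : Op (A × B)) (hX : X ∈ PPT A B) : |m * hs W X| ≤ 1 := by
    rw [h, abs_mul, abs_of_pos hm0]
    exact (mul_le_mul_of_nonneg_left (abs_hs_maxEnt_le (hΛ.2 X hX)) hm0.le).trans
      (mul_inv_cancel₀ hm0.ne').le
  have hconv : Convex ℝ {X : Op (A × B) | m * hs W X ≤ 1} := by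
    intro X hX Y hY a b ha hb hab
    change m * hs W (a • X + b • Y) ≤ 1
    change m * hs W X ≤ 1 at hX
    change m * hs W Y ≤ 1 at hY
    rw [hs_add_right, hs_smul_right, hs_smul_right]
    obtain rfl : b = 1 - a := by linarith
    nlinarith
  rw [PPTprime_eq_convexHull] at hX
  refine convexHull_min (Set.union_subset (fun Y hY => (abs_le.mp (key Y hY)).2)
    fun Y hY => ?_) hconv hX
  have := (abs_le.mp (key (-Y) hY)).1
  rw [hs_neg_right] at this
  change m * hs W Y ≤ 1
  linarith

/-- The polar of PPT' bounds m W^{T_B} between -1 and 1, exactly what the isotropic splitting of the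
partially transposed Choi matrix needs. -/
theorem exists_mem_PPTops_of_feasible {ρ : Op (A × B)} (hρ : IsState ρ) {m : ℕ} (hm : 1 ≤ m)
    {W : Op (A × B)} (hW : W ∈ feasible m (PPTprime A B)) :
    ∃ Λ ∈ PPTops A B (Fin m) (Fin m), hs ρ W ≤ hs (Λ ρ) (maxEnt m) := by
  obtain ⟨⟨hW, hW'⟩, hQ⟩ := hW
  rcases hm.eq_or_lt with rfl | hm2
  · refine ⟨measurePrepare 1 (maxEnt 1) (coMaxEnt 1),
      ⟨isCPTP_measurePrepare_maxEnt le_rfl PosSemidef.one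
        (by rw [sub_self]; exact PosSemidef.zero) (Or.inl rfl), ?_⟩, ?_⟩
    · rw [choi_measurePrepare, sub_self, transpose_zero, transpose_one, zero_kronecker, add_zero,
        ptBB'_kronecker, ptB_one]
      exact PosSemidef.one.kronecker ptB_maxEnt_one_posSemidef
    · rw [hs_measurePrepare le_rfl isHermitian_one hρ.1.1, hs_one_left, hρ.2, Complex.one_re]
      exact hs_le_one_of_effect hW' hρ
  · refine ⟨_, ⟨isCPTP_measurePrepare_maxEnt hm hW hW' (Or.inr hm2), ?_⟩,
      by rw [hs_measurePrepare hm hW.1 hρ.1.1, hs_comm]⟩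
    obtain ⟨h1, h2⟩ := posSemidef_one_add_sub_ptB (H := (m : ℝ) • W)
      (posSemidef_real_smul hW (Nat.cast_nonneg m)).1
      fun X hX => by rw [hs_smul_left]; exact hQ X hX
    have ht : (ptB W)ᵀ = ptB Wᵀ := rfl
    have key := posSemidef_kronecker_isotropic (w := (ptB W)ᵀ) hm2
      (by simpa [ptB_smul] using h1.transpose) (by simpa [ptB_smul] using h2.transpose)
    rwa [choi_measurePrepare, ptBB'_add, ptBB'_kronecker, ptBB'_kronecker, transpose_sub,
      transpose_one, ptB_sub, ptB_one]

theorem Fid_PPTpres [Nonempty A] [Nonempty B] {ρ : Op (A × B)} (hρ : IsState ρ) {m : ℕ}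
    (hm : 1 ≤ m) :
    Fid (fun k => PPTpres A B (Fin k) (Fin k)) ρ m = G m (PPTprime A B) ρ :=
  Fid_eq_G hm (fun _ hΛ => exists_feasible_of_mem_PPTpres hm hΛ) fun _ hW =>
    (exists_mem_PPTops_of_feasible hρ hm hW).imp fun _ h => ⟨PPTops_subset_PPTpres h.1, h.2⟩

theorem Fid_PPTops [Nonempty A] [Nonempty B] {ρ : Op (A × B)} (hρ : IsState ρ) {m : ℕ}
    (hm : 1 ≤ m) :
    Fid (fun k => PPTops A B (Fin k) (Fin k)) ρ m = G m (PPTprime A B) ρ :=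
  Fid_eq_G hm (fun _ hΛ => exists_feasible_of_mem_PPTpres hm (PPTops_subset_PPTpres hΛ))
    fun _ hW => exists_mem_PPTops_of_feasible hρ hm hW

theorem IsState.nonempty {ρ : Op (A × B)} (hρ : IsState ρ) : Nonempty (A × B) := by
  by_contra h
  rw [not_nonempty_iff] at h
  have := hρ.2
  simp [trace] at this

theorem hs_maximallyMixed_pos [Nonempty A] [Nonempty B] {M : Op (A × B)} (hM : M.PosSemidef)
    (h0 : M ≠ 0) : 0 < hs M ((Fintype.card (A × B) : ℝ)⁻¹ • (1 : Op (A × B))) := by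
  rw [hs_smul_right, hs_one_right]
  refine mul_pos (inv_pos.mpr (Nat.cast_pos.mpr Fintype.card_pos))
    ((trace_re_nonneg hM).lt_of_ne fun h => h0 ?_)
  rw [← hM.trace_eq_zero_iff, trace_eq_re hM.1, ← h, Complex.ofReal_zero]

theorem hs_one_le_of_mem_PPTprime {X : Op (A × B)} (hX : X ∈ PPTprime A B) : hs 1 X ≤ 1 := by
  obtain ⟨P, N, hP, hN, h, rfl⟩ := mem_PPTprime_iff.mp hX
  have := trace_re_nonneg hN
  rw [hs_one_left, trace_ptB, trace_sub, Complex.sub_re]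
  linarith

end Fidelity

end PPTDist

/-! ### The main theorem -/

theorem mainTheorem6 {A B : Type*} [Fintype A] [DecidableEq A] [Fintype B] [DecidableEq B]
    (ρ : PPTDist.Op (A × B)) (hρ : PPTDist.IsState ρ) :
    -- the two descriptions of the set PPT'
    PPTDist.PPTprime A B = convexHull ℝ (PPTDist.PPT A B ∪ -PPTDist.PPT A B) ∧
    -- fidelity of distillation
    (∀ m : ℕ, 1 ≤ m →
      PPTDist.Fid (fun k => PPTDist.PPTplusPres A B (Fin k) (Fin k)) ρ m
          = PPTDist.G m (PPTDist.PPTplus A B) ρ ∧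
      PPTDist.Fid (fun k => PPTDist.PPTops A B (Fin k) (Fin k)) ρ m
          = PPTDist.Fid (fun k => PPTDist.PPTpres A B (Fin k) (Fin k)) ρ m ∧
      PPTDist.Fid (fun k => PPTDist.PPTpres A B (Fin k) (Fin k)) ρ m
          = PPTDist.G m (PPTDist.PPTprime A B) ρ) ∧
    -- one-shot distillable entanglement
    (∀ ε : ℝ, 0 ≤ ε → ε ≤ 1 →
      (∃ t : EReal, IsLeast (PPTDist.DH ε ρ '' PPTDist.PPTplus A B) t ∧
        PPTDist.Edist (fun k => PPTDist.PPTplusPres A B (Fin k) (Fin k)) ε ρ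
          = PPTDist.logFloor t) ∧
      (∃ t : EReal, IsLeast (PPTDist.DH ε ρ '' PPTDist.PPTprime A B) t ∧
        PPTDist.Edist (fun k => PPTDist.PPTops A B (Fin k) (Fin k)) ε ρ
          = PPTDist.Edist (fun k => PPTDist.PPTpres A B (Fin k) (Fin k)) ε ρ ∧
        PPTDist.Edist (fun k => PPTDist.PPTpres A B (Fin k) (Fin k)) ε ρ
          = PPTDist.logFloor t)) ∧
    -- for `ε < 1` the maxima defining the one-shot distillable entanglement are attained
    (∀ ε : ℝ, 0 ≤ ε → ε < 1 →
      (∃ N : ℕ, IsGreatest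
        (PPTDist.achievable (fun k => PPTDist.PPTplusPres A B (Fin k) (Fin k)) ε ρ) N) ∧
      (∃ N : ℕ, IsGreatest
        (PPTDist.achievable (fun k => PPTDist.PPTops A B (Fin k) (Fin k)) ε ρ) N) ∧
      (∃ N : ℕ, IsGreatest
        (PPTDist.achievable (fun k => PPTDist.PPTpres A B (Fin k) (Fin k)) ε ρ) N)) := by
  -- Unit trace excludes empty index types, so the maximally mixed state exists; it is the `X₀` of
  -- the minimax argument for both sets.
  obtain ⟨hA, hB⟩ := nonempty_prod.mp hρ.nonempty
  have hmix := PPTDist.maximallyMixed_mem_PPTplus (A := A) (B := B)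
  have hsub : PPTDist.PPTplus A B ⊆ PPTDist.PPTprime A B :=
    PPTDist.PPTplus_subset_PPT.trans PPTDist.PPT_subset_PPTprime
  have hpos (M : PPTDist.Op (A × B)) (hM : M.PosSemidef) (h0 : M ≠ 0) :=
    PPTDist.hs_maximallyMixed_pos hM h0
  have hone (X : PPTDist.Op (A × B)) (hX : X ∈ PPTDist.PPTprime A B) :=
    PPTDist.hs_one_le_of_mem_PPTprime hX
  have hplus (m : ℕ) (hm : 1 ≤ m) := PPTDist.Fid_PPTplusPres hρ hm
  have hops (m : ℕ) (hm : 1 ≤ m) := PPTDist.Fid_PPTops hρ hm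
  have hpres (m : ℕ) (hm : 1 ≤ m) := PPTDist.Fid_PPTpres hρ hm
  refine ⟨PPTDist.PPTprime_eq_convexHull, fun m hm => ⟨hplus m hm,
    (hops m hm).trans (hpres m hm).symm, hpres m hm⟩, fun ε h0 h1 => ⟨?_, ?_⟩,
    fun ε h0 h1 => ⟨?_, ?_, ?_⟩⟩
  · exact PPTDist.Edist_eq_logFloor PPTDist.isCompact_PPTplus PPTDist.convex_PPTplus
      (fun X hX => hone X (hsub hX)) hmix hpos hρ hplus h0 h1
  · obtain ⟨t, ht, hE⟩ := PPTDist.Edist_eq_logFloor PPTDist.isCompact_PPTprime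
      PPTDist.convex_PPTprime hone (hsub hmix) hpos hρ hpres h0 h1
    exact ⟨t, ht, PPTDist.Edist_congr ε fun m hm => (hops m hm).trans (hpres m hm).symm, hE⟩
  · exact PPTDist.exists_isGreatest_achievable PPTDist.isCompact_PPTplus PPTDist.convex_PPTplus
      (fun X hX => hone X (hsub hX)) hmix hpos hρ hplus h0 h1
  · exact PPTDist.exists_isGreatest_achievable PPTDist.isCompact_PPTprime
      PPTDist.convex_PPTprime hone (hsub hmix) hpos hρ hops h0 h1
  · exact PPTDist.exists_isGreatest_achievable PPTDist.isCompact_PPTprime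
      PPTDist.convex_PPTprime hone (hsub hmix) hpos hρ hpres h0 h1
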